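/- All matroids are finite. For a matroid $M$, a set $S\subseteq E(M)$ and a new element $e\notin E(M)$, *freely placing $e$ in the flat spanned by $S$* means passing to the matroid $M'$ on $E(M)\cup\{e\}$ with $M'\setminus e=M$ in which a set $X\subseteq E(M)$ spans $e$ if and only if $X$ spans $S$. For distinct elements $a,b$ of $M$, let $M_{a\to b}$ be the matroid obtained from $M$ by freely placing a new element $c$ in the flat spanned by $\{a,b\}$, deleting $a$, and relabelling $c$ as $a$. Elements $p,q$ of $M$ are an *incomparable pair* if some subset of $E(M)\setminus\{p,q\}$ spans $p$ but not $q$, and some subset of $E(M)\setminus\{p,q\}$ spans $q$ but not $p$. An *excluded minor for $\mathbb F$-representability* is a matroid that is not $\mathbb F$-representable but all of whose proper minors are. Let $L$ and $N$ be matroids with disjoint ground sets, let $p\neq q$ be elements of $L$, and let $(A,B)$ be a partition of $E(N)$ into two bases of $N$. The matroid $M(L,p,q;N,A,B)$ is built as follows. Starting from $N\oplus L$, freely place new elements $a$ and $b$ in the flats spanned by $E(N)\cup\{p\}$ and $E(N)\cup\{q\}$, respectively; then, for each $x\in A$, freely place a new element $x_a$ in the flat spanned by $\{x,a\}$ and,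 for each $y\in B$, freely place a new element $y_b$ in the flat spanned by $\{y,b\}$. Next, delete all the elements of $E(N)$, and relabel $x_a$ as $x$ for each $x\in A$ and $y_b$ as $y$ for each $y\in B$. Finally, delete $p$ and $q$. **Theorem.** Let $\mathbb F$ be an infinite field. Suppose that - $L$ is an excluded minor for $\mathbb F$-representability, - $p,q$ is an incomparable pair of elements of $L$ such that $L_{p\to q}$ and $L_{q\to p}$ are both $\mathbb F$-representable, - $N$ is an $\mathbb F$-representable matroid with $E(N)\cap E(L)=\emptyset$, and - $(A,B)$ is a partition of $E(N)$ into two bases of $N$. Then, for every order in which the elements $x_a$ ($x\in A$) and then $y_b$ ($y\in B$) are placed, $M(L,p,q;N,A,B)$ is an excluded minor for $\mathbb F$-representability. -/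

import Mathlib

open Set

namespace Matroid

open scoped Matroid

universe u v

variable {α : Type u} {β : Type v}

/-- Independent sets of the matroid obtained from `M` by freely placing `e` in the flat `F`:
either an independent set of `M`, or `insert e I` where `I` is independent and does not span `F`.
(This is used for `e ∉ M.E` and for a flat `F` of `M`.) -/
def PlaceIndep (M : Matroid α) (F : Set α) (e : α) (I : Set α) : Prop :=
  M.Indep (I \ {e}) ∧ (e ∈ I → ¬ F ⊆ M.closure (I \ {e}))

lemma placeIndep_maximal (M : Matroid α) {F : Set α} {e : α} (X : Set α)
    (hX : X ⊆ insert e M.E) : ExistsMaximalSubsetProperty (M.PlaceIndep F e) X := by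
  intro I hI hIX
  have hYE : X \ {e} ⊆ M.E := by
    rintro x ⟨hx, hxe⟩
    exact (hX hx).resolve_left hxe
  obtain ⟨J, hJ, hIJ⟩ := hI.1.subset_isBasis_of_subset (sdiff_subset_sdiff_left hIX) hYE
  have heJ : e ∉ J := fun h ↦ (hJ.subset h).2 rfl
  have key : ∀ K : Set α, M.PlaceIndep F e K → K ⊆ X → J ⊆ K → K \ {e} = J := fun K hK hKX hJK ↦
    (hJ.eq_of_subset_indep hK.1 (subset_sdiff_singleton hJK heJ)
      (sdiff_subset_sdiff_left hKX)).symm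
  by_cases heX : e ∈ X
  swap
  · have hIe : I \ {e} = I := sdiff_singleton_eq_self (fun h ↦ heX (hIX h))
    refine ⟨J, hIe ▸ hIJ, ⟨⟨by simpa [sdiff_singleton_eq_self heJ] using hJ.indep,
      fun h ↦ (heJ h).elim⟩, hJ.subset.trans sdiff_subset⟩, ?_⟩
    rintro K ⟨hK, hKX⟩ hJK
    rw [← key K hK hKX hJK, sdiff_singleton_eq_self (fun h ↦ heX (hKX h))]
  by_cases hsp : F ⊆ M.closure (X \ {e})
  swap
  · have h1 : insert e J \ {e} = J := by simp [heJ]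
    refine ⟨insert e J, ?_, ⟨⟨by rw [h1]; exact hJ.indep, fun _ ↦ ?_⟩,
      insert_subset heX (hJ.subset.trans sdiff_subset)⟩, ?_⟩
    · rwa [← sdiff_singleton_subset_iff]
    · rwa [h1, hJ.closure_eq_closure]
    rintro K ⟨hK, hKX⟩ hJK
    rw [← key K hK hKX ((subset_insert _ _).trans hJK), insert_sdiff_singleton]
    exact subset_insert _ _
  by_cases heI : e ∈ I
  swap
  · have hIe : I \ {e} = I := sdiff_singleton_eq_self heI
    refine ⟨J, hIe ▸ hIJ, ⟨⟨by simpa [sdiff_singleton_eq_self heJ] using hJ.indep,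
      fun h ↦ (heJ h).elim⟩, hJ.subset.trans sdiff_subset⟩, ?_⟩
    rintro K ⟨hK, hKX⟩ hJK
    have hk := key K hK hKX hJK
    have : e ∉ K := fun h ↦ hK.2 h (by rwa [hk, hJ.closure_eq_closure])
    rw [← hk, sdiff_singleton_eq_self this]
  -- now `e ∈ I` and `X \ {e}` spans `F`
  obtain ⟨f, hfF, hf⟩ := not_subset.1 (hI.2 heI)
  have hfJ : f ∈ M.closure J := by rw [hJ.closure_eq_closure]; exact hsp hfF
  obtain ⟨j, hjJ, hjI, hj⟩ : ∃ j ∈ J, j ∉ I \ {e} ∧ f ∉ M.closure (J \ {j}) := by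
    by_cases hfJ' : f ∈ J
    · exact ⟨f, hfJ', fun h ↦ hf (M.subset_closure _ hI.1.subset_ground h),
        hJ.indep.notMem_closure_sdiff_of_mem hfJ'⟩
    have hC := hJ.indep.fundCircuit_isCircuit hfJ hfJ'
    by_contra! hcon
    have hsub : M.fundCircuit f J ⊆ insert f (I \ {e}) := by
      intro j hj
      by_cases hjf : j = f
      · exact Or.inl hjf
      have hjJ : j ∈ J := (M.fundCircuit_subset_insert f J hj).resolve_left hjf
      by_contra hjn
      have := hcon j hjJ (fun h ↦ hjn (Or.inr h))
      exact ((hJ.indep.mem_fundCircuit_iff hfJ hfJ').1 hj).not_dep <| by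
        rw [← insert_sdiff_singleton_comm (Ne.symm hjf)]
        exact (((hJ.indep.sdiff {j}).mem_closure_iff).1 this).resolve_right (fun h ↦ hfJ' h.1)
    exact hf <| M.closure_subset_closure
      (sdiff_singleton_subset_iff.2 hsub) (hC.mem_closure_sdiff_singleton_of_mem
        (M.mem_fundCircuit f J))
  have hje : j ≠ e := fun h ↦ heJ (h ▸ hjJ)
  have heJj : e ∉ J \ {j} := fun h ↦ heJ h.1
  have h1 : insert e (J \ {j}) \ {e} = J \ {j} := by simp [heJ]
  refine ⟨insert e (J \ {j}), ?_, ⟨⟨by rw [h1]; exact hJ.indep.sdiff _, fun _ h ↦ ?_⟩,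
      insert_subset heX (sdiff_subset.trans (hJ.subset.trans sdiff_subset))⟩, ?_⟩
  · rw [← sdiff_singleton_subset_iff]
    exact subset_sdiff_singleton hIJ hjI
  · rw [h1] at h
    exact hj (h hfF)
  rintro K ⟨hK, hKX⟩ hJK k hk
  by_contra hkn
  have hke : k ≠ e := fun h ↦ hkn (Or.inl h)
  have hkJ : k ∉ J \ {j} := fun h ↦ hkn (Or.inr h)
  refine hK.2 (hJK (mem_insert _ _)) ?_
  have hsub : J \ {j} ⊆ K \ {e} :=
    subset_sdiff_singleton ((subset_insert _ _).trans hJK) heJj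
  have hkcl : k ∈ M.closure (insert j (J \ {j})) := by
    rw [insert_sdiff_singleton, insert_eq_of_mem hjJ, hJ.closure_eq_closure]
    exact M.subset_closure _ hYE ⟨hKX hk, hke⟩
  have hkn' : k ∉ M.closure (J \ {j}) := fun h ↦
    (hK.1.notMem_closure_sdiff_of_mem ⟨hk, hke⟩)
      (M.closure_subset_closure (subset_sdiff_singleton hsub hkJ) h)
  have hjk := (M.closure_exchange ⟨hkcl, hkn'⟩).1
  refine hsp.trans ?_
  rw [← hJ.closure_eq_closure]
  refine M.closure_subset_closure_of_subset_closure fun x hx ↦ ?_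
  by_cases hxj : x = j
  · subst hxj
    exact M.closure_subset_closure (insert_subset (show k ∈ K \ {e} from ⟨hk, hke⟩) hsub) hjk
  · exact M.subset_closure _ hK.1.subset_ground (hsub ⟨hx, hxj⟩)

lemma placeIndep_aug (M : Matroid α) {F : Set α} {e : α} (hF : F ⊆ M.E) (he : e ∉ M.E)
    {I B : Set α} (hI : M.PlaceIndep F e I) (hInm : ¬ Maximal (M.PlaceIndep F e) I)
    (hB : Maximal (M.PlaceIndep F e) B) : ∃ x ∈ B \ I, M.PlaceIndep F e (insert x I) := by
  by_contra! H
  have hBE := hB.prop.1.subset_ground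
  have hIE := hI.1.subset_ground
  -- a witness of non-maximality
  obtain ⟨x, hxI, hx⟩ : ∃ x, x ∉ I ∧ M.PlaceIndep F e (insert x I) := by
    simp only [Maximal, hI, true_and, not_forall] at hInm
    obtain ⟨K, hK, hIK, hKI⟩ := hInm
    obtain ⟨x, hxK, hxI⟩ := not_subset.1 hKI
    have hsub := insert_subset hxK hIK
    exact ⟨x, hxI, hK.1.subset (sdiff_subset_sdiff_left hsub), fun h1 h2 ↦
      hK.2 (hsub h1) (h2.trans (M.closure_subset_closure (sdiff_subset_sdiff_left hsub)))⟩
  have hins : ∀ {y : α} (S : Set α), y ≠ e → insert y S \ {e} = insert y (S \ {e}) :=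
    fun S h ↦ (insert_sdiff_singleton_comm h S).symm
  -- extending `B` by an element of the ground set
  have hBx : ∀ y ∈ M.E, y ∉ M.closure (B \ {e}) → e ∈ B ∧ F ⊆ M.closure (insert y (B \ {e})) := by
    intro y hyE hy
    have hye : y ≠ e := fun h ↦ he (h ▸ hyE)
    have hyB : y ∉ B := fun h ↦ hy (M.subset_closure _ hBE ⟨h, hye⟩)
    by_contra hcon
    refine hyB (hB.le_of_ge (y := insert y B) ⟨?_, ?_⟩ (subset_insert _ _) (mem_insert _ _))
    · rw [hins _ hye, hB.prop.1.insert_indep_iff]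
      exact Or.inl ⟨hyE, hy⟩
    · rw [hins _ hye]
      exact fun h h2 ↦ hcon ⟨h.resolve_left hye.symm, h2⟩
  by_cases heI : e ∈ I
  · have hxe : x ≠ e := fun h ↦ hxI (h ▸ heI)
    have hx1 := hx.1
    have hx2 := hx.2 (Or.inr heI)
    rw [hins _ hxe] at hx1 hx2
    obtain ⟨f, hfF, hf⟩ := not_subset.1 hx2
    have hxE : x ∈ M.E := hx1.subset_ground (mem_insert _ _)
    have hfE := hF hfF
    have hxcl : x ∉ M.closure (I \ {e}) := by
      have := hx1.notMem_closure_sdiff_of_mem (mem_insert _ _)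
      rwa [insert_sdiff_self_of_notMem (fun h ↦ hxI h.1)] at this
    have hxf : x ∉ M.closure (insert f (I \ {e})) := fun h ↦ hf (M.closure_exchange ⟨h, hxcl⟩).1
    have hfI : f ∉ M.closure (I \ {e}) := fun h ↦
      hf (M.closure_subset_closure (subset_insert _ _) h)
    have hIf : M.closure (I \ {e}) ⊆ M.closure (insert f (I \ {e})) :=
      M.closure_subset_closure (subset_insert _ _)
    have hy : ∀ y ∈ B \ {e}, y ∉ M.closure (I \ {e}) → F ⊆ M.closure (insert y (I \ {e})) := by
      intro y hyB hyI
      have hyI' : y ∉ I := fun h ↦ hyI (M.subset_closure _ hIE ⟨h, hyB.2⟩)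
      have h1 := H y ⟨hyB.1, hyI'⟩
      simp only [PlaceIndep, hins I hyB.2, not_and, not_forall, not_not] at h1
      exact (h1 ((hI.1.insert_indep_iff).2 (Or.inl ⟨hBE hyB, hyI⟩))).2
    have hyf : B \ {e} ⊆ M.closure (insert f (I \ {e})) := by
      intro y hyB
      by_cases hyI : y ∈ M.closure (I \ {e})
      · exact hIf hyI
      · exact (M.closure_exchange ⟨hy y hyB hyI hfF, hfI⟩).1
    have hxB : x ∉ M.closure (B \ {e}) := fun h ↦
      hxf (M.closure_subset_closure_of_subset_closure hyf h)
    obtain ⟨heB, hFB⟩ := hBx x hxE hxB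
    obtain ⟨g, hgF, hg⟩ := not_subset.1 (hB.prop.2 heB)
    by_cases hall : B \ {e} ⊆ M.closure (I \ {e})
    · refine hx2 (hFB.trans (M.closure_subset_closure_of_subset_closure (insert_subset ?_ ?_)))
      · exact M.subset_closure _ hx1.subset_ground (mem_insert _ _)
      · exact hall.trans (M.closure_subset_closure (subset_insert _ _))
    · obtain ⟨y, hyB, hyI⟩ := not_subset.1 hall
      have hF' : F ⊆ M.closure (insert f (I \ {e})) :=
        (hy y hyB hyI).trans (M.closure_subset_closure_of_subset_closure (insert_subset (hyf hyB)
          ((subset_insert _ _).trans (M.subset_closure _ (insert_subset hfE hIE)))))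
      exact hxf (M.closure_subset_closure_of_subset_closure (insert_subset (hF' hgF) hyf)
        (M.closure_exchange ⟨hFB hgF, hg⟩).1)
  · have hIe : I \ {e} = I := sdiff_singleton_eq_self heI
    rw [hIe] at hIE
    have hII : M.Indep I := hIe ▸ hI.1
    have hBI : B \ {e} ⊆ M.closure I := by
      intro y hy
      by_contra hyI
      have hyI' : y ∉ I := fun h ↦ hyI (M.subset_closure _ hIE h)
      refine H y ⟨hy.1, hyI'⟩ ⟨?_, fun h ↦ (h.elim (fun h ↦ hy.2 h.symm) heI).elim⟩
      rw [hins _ hy.2, hIe, hII.insert_indep_iff]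
      exact Or.inl ⟨hBE hy, hyI⟩
    have hBI' := M.closure_subset_closure_of_subset_closure hBI
    by_cases heB : e ∈ B
    · have hFI : F ⊆ M.closure I := by
        by_contra hcon
        refine H e ⟨heB, heI⟩ ?_
        have h1 : insert e I \ {e} = I := by simp [heI]
        exact ⟨by rwa [h1], fun _ ↦ by rwa [h1]⟩
      have hxe : x ≠ e := by
        rintro rfl
        have h1 : insert x I \ {x} = I := by simp [heI]
        exact (h1 ▸ hx.2 (mem_insert _ _)) hFI
      have hx1 := hx.1
      rw [hins _ hxe, hIe] at hx1
      have hxE : x ∈ M.E := hx1.subset_ground (mem_insert _ _)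
      have hxcl : x ∉ M.closure I := by
        have := hx1.notMem_closure_sdiff_of_mem (mem_insert _ _)
        rwa [insert_sdiff_self_of_notMem hxI] at this
      obtain ⟨-, hFB⟩ := hBx x hxE (fun h ↦ hxcl (hBI' h))
      obtain ⟨g, hgF, hg⟩ := not_subset.1 (hB.prop.2 heB)
      exact hxcl (M.closure_subset_closure_of_subset_closure (insert_subset (hFI hgF) hBI)
        (M.closure_exchange ⟨hFB hgF, hg⟩).1)
    · have hsp : M.E ⊆ M.closure I := fun y hy ↦ hBI' <| by
        by_contra hcon
        exact heB (hBx y hy hcon).1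
      by_cases hxe : x = e
      · subst hxe
        have h1 : insert x I \ {x} = I := by simp [heI]
        exact (h1 ▸ hx.2 (mem_insert _ _)) (hF.trans hsp)
      have hx1 := hx.1
      rw [hins _ hxe, hIe] at hx1
      have := hx1.notMem_closure_sdiff_of_mem (mem_insert _ _)
      rw [insert_sdiff_self_of_notMem hxI] at this
      exact this (hsp (hx1.subset_ground (mem_insert _ _)))

/-- The matroid obtained from `M` by freely placing a new element `e ∉ M.E` in the flat spanned
by `S`, i.e. the principal extension of `M` into the flat `M.closure S`: an extension of `M` by `e`
in which a subset of `M.E` spans `e` if and only if it spans `S`; see `placeFreely_delete` and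
`mem_closure_placeFreely_iff`. (Should `e` already belong to `M`, it is deleted first.) -/
noncomputable def placeFreely (M : Matroid α) (S : Set α) (e : α) : Matroid α :=
  IndepMatroid.matroid
  { E := insert e (M ＼ {e}).E
    Indep := (M ＼ {e}).PlaceIndep ((M ＼ {e}).closure S) e
    indep_empty := by simp [PlaceIndep]
    indep_subset := fun I J hJ hIJ ↦ ⟨hJ.1.subset (sdiff_subset_sdiff_left hIJ), fun he h ↦
      hJ.2 (hIJ he) (h.trans (closure_subset_closure _ (sdiff_subset_sdiff_left hIJ)))⟩
    indep_aug := fun _ _ hI hIm hB ↦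
      placeIndep_aug _ (closure_subset_ground _ _) (by simp) hI hIm hB
    indep_maximal := placeIndep_maximal _
    subset_ground := fun I hI ↦ by
      rw [← sdiff_singleton_subset_iff]
      exact hI.1.subset_ground }

@[simp] lemma placeFreely_ground (M : Matroid α) (S : Set α) (e : α) :
    (M.placeFreely S e).E = insert e M.E := by
  simp [placeFreely]

lemma placeFreely_indep_iff (M : Matroid α) (S : Set α) {e : α} (he : e ∉ M.E) (I : Set α) :
    (M.placeFreely S e).Indep I ↔
      M.Indep (I \ {e}) ∧ (e ∈ I → ¬ M.closure S ⊆ M.closure (I \ {e})) := by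
  have h : M ＼ {e} = M := by simpa using he
  simp [placeFreely, PlaceIndep, h]

lemma placeFreely_delete (M : Matroid α) (S : Set α) {e : α} (he : e ∉ M.E) :
    M.placeFreely S e ＼ {e} = M := by
  refine ext_indep (by simp [he]) fun I hI ↦ ?_
  have heI : e ∉ I := fun h ↦ (hI h).2 rfl
  simp [delete_indep_iff, placeFreely_indep_iff M S he, heI]

/-- A subset `X` of `M.E` spans the new element if and only if it spans `S`. -/
lemma mem_closure_placeFreely_iff (M : Matroid α) {S : Set α} {e : α} (he : e ∉ M.E)
    (hS : S ⊆ M.E) {X : Set α} (hX : X ⊆ M.E) :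
    e ∈ (M.placeFreely S e).closure X ↔ S ⊆ M.closure X := by
  obtain ⟨I, hI⟩ := M.exists_isBasis X
  have heX : e ∉ X := fun h ↦ he (hX h)
  have heI : e ∉ I := fun h ↦ heX (hI.subset h)
  have hI' : (M.placeFreely S e).IsBasis I X := by
    rw [← placeFreely_delete M S he, delete_isBasis_iff] at hI
    exact hI.1
  rw [← hI'.closure_eq_closure, ← hI.closure_eq_closure, hI'.indep.mem_closure_iff_of_notMem heI,
    dep_iff, placeFreely_indep_iff M S he]
  have h1 : insert e I \ {e} = I := by simp [heI]
  have h2 : insert e I ⊆ insert e M.E := insert_subset_insert hI.indep.subset_ground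
  simp only [h1, hI.indep, true_and, mem_insert, forall_const, not_not, placeFreely_ground, h2,
    and_true]
  exact closure_subset_closure_iff_subset_closure hS

/-- `M` with the element `a` moved freely towards `b`: freely place a new element `c` in the
flat spanned by `{a, b}`, delete `a`, and relabel `c` as `a`. The new element `c` is the element
`none` of `Option α`. -/
noncomputable def moveTowards (M : Matroid α) (a b : α) : Matroid α :=
  open Classical in
  (((M.mapEmbedding Function.Embedding.some).placeFreely {some a, some b} none) ＼ {some a}).comap
    (Function.update some a none)

@[simp] lemma moveTowards_ground (M : Matroid α) {a b : α} (ha : a ∈ M.E) :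
    (M.moveTowards a b).E = M.E := by
  ext x
  by_cases hx : x = a
  · subst hx
    simp [moveTowards, ha]
  · simp [moveTowards, hx]

/-- `p` and `q` are an incomparable pair of elements of `M`: some set avoiding `p` and `q` spans
`p` but not `q`, and some such set spans `q` but not `p`. -/
def IncomparablePair (M : Matroid α) (p q : α) : Prop :=
  p ∈ M.E ∧ q ∈ M.E ∧
  (∃ Y ⊆ M.E \ {p, q}, p ∈ M.closure Y ∧ q ∉ M.closure Y) ∧
  (∃ Y ⊆ M.E \ {p, q}, q ∈ M.closure Y ∧ p ∉ M.closure Y)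

/-- A (finite) matroid `M` is representable over `F`: it is the matroid of the columns, indexed
by the elements of `M`, of a matrix over `F`. -/
def RepresentableOver (M : Matroid α) (F : Type*) [Field F] : Prop :=
  ∃ (n : ℕ) (v : α → Fin n → F), ∀ I ⊆ M.E, M.Indep I ↔ LinearIndepOn F v I

/-- A finite matroid that is not `F`-representable, while all of its proper minors are. -/
def IsExcludedMinorFor (M : Matroid α) (F : Type*) [Field F] : Prop :=
  M.Finite ∧ ¬ M.RepresentableOver F ∧ ∀ M', M' <m M → M'.RepresentableOver F

/-- The elements used in the construction: those of `L`, those of `N`, the two new elements `a` and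
`b`, and, for each element `x` of `N`, a new element `lift x` (called `x_a` if `x ∈ A`
and `x_b` if `x ∈ B`). -/
inductive Elt (α : Type u) (β : Type v) : Type (max u v)
  | ofL (e : α)
  | ofN (x : β)
  | a
  | b
  | lift (x : β)

namespace Elt

/-- The relabelling that exchanges the names of `x` and `lift x`, for each `x` of `N`. -/
def swapLift : Elt α β ≃ Elt α β where
  toFun
    | ofL e => ofL e
    | ofN x => lift x
    | a => a
    | b => b
    | lift x => ofN x
  invFun
    | ofL e => ofL e
    | ofN x => lift x
    | a => a
    | b => b
    | lift x => ofN x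
  left_inv := by rintro (_ | _ | _ | _ | _) <;> rfl
  right_inv := by rintro (_ | _ | _ | _ | _) <;> rfl

/-- The inclusion of the elements of `N` and `L`. -/
def ofSum : β ⊕ α ↪ Elt α β where
  toFun := Sum.elim ofN ofL
  inj' := by rintro (_ | _) (_ | _) h <;> simp_all

end Elt

/-- For each `x` in the list `l`, in turn, freely place `lift x` in the flat spanned
by `{x, c}`. -/
noncomputable def placeLifts (M : Matroid (Elt α β)) (c : Elt α β) (l : List β) : Matroid (Elt α β) :=
  l.foldl (fun M' x ↦ M'.placeFreely {Elt.ofN x, c} (Elt.lift x)) M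

/-- First stage of the construction: from `N ⊕ L`, freely place `a` and `b` in the flats spanned by
`E(N) ∪ {p}` and `E(N) ∪ {q}`, then freely place `x_a` in the flat spanned by `{x, a}` for each
`x ∈ A` and `y_b` in the flat spanned by `{y, b}` for each `y ∈ B`. -/
noncomputable def construction₁ (L : Matroid α) (p q : α) (N : Matroid β) (A B : List β) :
    Matroid (Elt α β) :=
  placeLifts (placeLifts
    ((((N.sum L).mapEmbedding Elt.ofSum).placeFreely
        (insert (Elt.ofL p) (Elt.ofN '' N.E)) Elt.a).placeFreely
        (insert (Elt.ofL q) (Elt.ofN '' N.E)) Elt.b)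
    Elt.a A) Elt.b B

/-- Second stage: delete each element `x` of `N` and relabel `lift x` as `x`. -/
noncomputable def construction₂ (L : Matroid α) (p q : α) (N : Matroid β) (A B : List β) :
    Matroid (Elt α β) :=
  (construction₁ L p q N A B ＼ (Elt.ofN '' N.E)).mapEquiv Elt.swapLift

/-- The matroid `M(L, p, q; N, A, B)`. The sets `A` and `B` are given by lists, which fix the order
in which the elements of the first stage are placed. -/
noncomputable def construction (L : Matroid α) (p q : α) (N : Matroid β) (A B : List β) :
    Matroid (Elt α β) :=
  construction₂ L p q N A B ＼ {Elt.ofL p, Elt.ofL q}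

end Matroid

/-!
Let `M = M(L, p, q; N, A, B)`. Unfolding the free placements, a set is independent in `M` if and
only if its elements outside `L` can be used as distinct elements of `N ∪ {a, b}`, each element of
`A` (resp. `B`) as itself or as `a` (resp. `b`), so that the result is independent; there `a` and
`b` may in turn be used as `p` and `q`, and must be once the rank of `N` is exhausted.

It follows that replacing `L` by `L_{p→q}` affects only sets that contain `A ∪ {a}` and avoid
`B ∪ {b}`, and symmetrically for `L_{q→p}`. So deleting or contracting an element outside `L` gives
the same matroid as for `L_{p→q}` or for `L_{q→p}`, whereas deleting or contracting an element of
`L` amounts to doing so in `L`. In each case the matroid arises from representable ones by free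
placements, which preserve representability over an infinite field.

Conversely, suppose that `M` is represented, and let `U₁` and `U₂` be the spans of `A ∪ {a}` and
`B ∪ {b}`. A set `X ⊆ E(L) \ {p, q}` is independent with `p` (resp. `q`) in `L` exactly when it is
represented by independent vectors whose span is disjoint from `U₁` (resp. `U₂`), and similarly
for both and `U₁ + U₂`. Since `U₁ ∩ U₂` has codimension one in `U₁` and in `U₂`, incomparability
forces the span of `E(L) \ {p, q}` to be disjoint from `U₁ ∩ U₂`. The quotient by `U₁ ∩ U₂`, with
vectors of `U₁ \ U₂` and `U₂ \ U₁` for `p` and `q`, then represents `L`, a contradiction.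
-/

namespace MatroidConstruction

open Matroid Submodule

open scoped Matroid

/-! ### Representations -/

section Representations

variable {F : Type*} [Field F] {V : Type*} [AddCommGroup V] [Module F V]
  {α β : Type*} {M : Matroid α}

/-- The family of vectors `v`, in a space of any dimension, represents `M` over `F`. The vectors
`v e` with `e ∉ M.E` are arbitrary. -/
def Represents (F : Type*) [Field F] {V : Type*} [AddCommGroup V] [Module F V] {α : Type*}
    (M : Matroid α) (v : α → V) : Prop :=
  ∀ I ⊆ M.E, M.Indep I ↔ LinearIndepOn F v I

lemma exists_represents (hM : M.RepresentableOver F) :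
    ∃ (n : ℕ) (v : α → Fin n → F), Represents F M v :=
  hM

namespace Represents

lemma representableOver [FiniteDimensional F V] {v : α → V} (h : Represents F M v) :
    M.RepresentableOver F := by
  let φ : V ≃ₗ[F] (Fin (Module.finrank F V) → F) := (Module.finBasis F V).equivFun
  refine ⟨_, φ ∘ v, fun I hI ↦ (h I hI).trans ?_⟩
  exact (φ.toLinearMap.linearIndepOn_iff_of_injOn φ.injective.injOn).symm

lemma mem_closure_iff_of_indep {v : α → V} (h : Represents F M v) {I : Set α} (hI : M.Indep I)
    {e : α} (he : e ∈ M.E) : e ∈ M.closure I ↔ v e ∈ span F (v '' I) := by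
  rw [hI.mem_closure_iff', and_iff_right he, h _ (insert_subset he hI.subset_ground),
    ((h I hI.subset_ground).1 hI).mem_span_iff]

lemma span_image_eq_of_isBasis {v : α → V} (h : Represents F M v) {I X : Set α}
    (hI : M.IsBasis I X) : span F (v '' I) = span F (v '' X) := by
  refine le_antisymm (span_mono (image_mono hI.subset)) (span_le.2 ?_)
  rintro _ ⟨x, hx, rfl⟩
  exact (h.mem_closure_iff_of_indep hI.indep (hI.subset_ground hx)).1 (hI.subset_closure hx)

lemma mem_closure_iff {v : α → V} (h : Represents F M v) {X : Set α} (hX : X ⊆ M.E) {e : α}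
    (he : e ∈ M.E) : e ∈ M.closure X ↔ v e ∈ span F (v '' X) := by
  obtain ⟨I, hI⟩ := M.exists_isBasis X
  rw [← hI.closure_eq_closure, ← h.span_image_eq_of_isBasis hI,
    h.mem_closure_iff_of_indep hI.indep he]

end Represents

lemma linearIndepOn_image_iff {v : β → V} {f : α → β} {s : Set α} (hf : InjOn f s) :
    LinearIndepOn F v (f '' s) ↔ LinearIndepOn F (v ∘ f) s :=
  ⟨fun h ↦ h.comp_of_image hf, fun h ↦ h.image_of_comp⟩

lemma representableOver_mapEmbedding (hM : M.RepresentableOver F) (f : α ↪ β) :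
    (M.mapEmbedding f).RepresentableOver F := by
  obtain ⟨n, v, hv⟩ := hM
  refine ⟨n, Function.extend f v 0, fun I hI ↦ ?_⟩
  obtain ⟨J, hJ, rfl⟩ := subset_image_iff.1 hI
  rw [linearIndepOn_image_iff f.injective.injOn, Function.extend_comp f.injective, ← hv J hJ,
    mapEmbedding_indep_iff, preimage_image_eq _ f.injective,
    and_iff_left (image_subset_range f J)]

lemma representableOver_sum {N : Matroid β} (hM : M.RepresentableOver F)
    (hN : N.RepresentableOver F) : (M.sum N).RepresentableOver F := by
  obtain ⟨m, v, hv⟩ := hM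
  obtain ⟨n, w, hw⟩ := hN
  let inl := LinearMap.inl F (Fin m → F) (Fin n → F)
  let inr := LinearMap.inr F (Fin m → F) (Fin n → F)
  refine Represents.representableOver (v := Sum.elim (inl ∘ v) (inr ∘ w)) fun I hI ↦ ?_
  have hI_eq : Sum.inl '' (Sum.inl ⁻¹' I) ∪ Sum.inr '' (Sum.inr ⁻¹' I) = I :=
    image_preimage_inl_union_image_preimage_inr I
  have hIM : Sum.inl ⁻¹' I ⊆ M.E := fun x hx ↦ by simpa using hI hx
  have hIN : Sum.inr ⁻¹' I ⊆ N.E := fun x hx ↦ by simpa using hI hx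
  have hdisj : Disjoint (span F ((inl ∘ v) '' (Sum.inl ⁻¹' I)))
      (span F ((inr ∘ w) '' (Sum.inr ⁻¹' I))) := by
    refine LinearMap.disjoint_inl_inr.mono (span_le.2 ?_) (span_le.2 ?_)
    · rintro _ ⟨x, -, rfl⟩
      exact ⟨v x, rfl⟩
    · rintro _ ⟨x, -, rfl⟩
      exact ⟨w x, rfl⟩
  rw [← hI_eq, linearIndepOn_union_iff disjoint_image_inl_image_inr, hI_eq,
    linearIndepOn_image_iff Sum.inl_injective.injOn,
    linearIndepOn_image_iff Sum.inr_injective.injOn, image_image, image_image, sum_indep_iff,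
    hv _ hIM, hw _ hIN]
  simp only [Sum.elim_comp_inl, Sum.elim_comp_inr, Sum.elim_inl, Sum.elim_inr]
  rw [LinearMap.linearIndepOn_iff_of_injOn _ LinearMap.inl_injective.injOn,
    LinearMap.linearIndepOn_iff_of_injOn _ LinearMap.inr_injective.injOn]
  exact and_congr_right fun _ ↦ (and_iff_left hdisj).symm

lemma representableOver_delete (hM : M.RepresentableOver F) (D : Set α) :
    (M ＼ D).RepresentableOver F := by
  obtain ⟨n, v, hv⟩ := hM
  refine ⟨n, v, fun I hI ↦ ?_⟩
  rw [delete_indep_iff, and_iff_left (subset_sdiff.1 hI).2, hv I (subset_sdiff.1 hI).1]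

lemma representableOver_contract (hM : M.RepresentableOver F) (C : Set α) :
    (M ／ C).RepresentableOver F := by
  obtain ⟨n, v, hv⟩ := hM
  obtain ⟨I, hI⟩ := M.exists_isBasis' C
  refine Represents.representableOver (v := mkQ (span F (v '' I)) ∘ v) fun J hJ ↦ ?_
  obtain ⟨hJE, hJC⟩ := subset_sdiff.1 hJ
  have hIv := (hv I hI.indep.subset_ground).1 hI.indep
  rw [hI.contract_indep_iff, and_iff_left hJC.symm, union_comm,
    hIv.quotient_iff_union (hJC.symm.mono_left hI.subset),
    hv _ (union_subset hI.indep.subset_ground hJE)]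

lemma representableOver_of_isMinor {N : Matroid α} (hM : M.RepresentableOver F) (h : N ≤m M) :
    N.RepresentableOver F := by
  obtain ⟨C, D, rfl⟩ := h
  exact representableOver_delete (representableOver_contract hM C) D

lemma exists_mem_forall_mem_imp_le [Infinite F] (U : Submodule F V) {𝒮 : Set (Submodule F V)}
    (h𝒮 : 𝒮.Finite) : ∃ w ∈ U, ∀ S ∈ 𝒮, w ∈ S → U ≤ S := by
  classical
  obtain ⟨w, hw⟩ := (ne_univ_iff_exists_notMem _).1 <| Subspace.biUnion_ne_univ_of_top_notMem
    (k := F) (E := U) (s := (h𝒮.toFinset.image fun S ↦ S.comap U.subtype).erase ⊤) (by simp)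
  refine ⟨w, w.2, fun S hS hwS ↦ comap_subtype_eq_top.1 ?_⟩
  by_contra hne
  refine hw (mem_biUnion (x := S.comap U.subtype) ?_ hwS)
  exact Finset.mem_erase.2 ⟨hne, Finset.mem_image_of_mem _ (h𝒮.mem_toFinset.2 hS)⟩

lemma placeFreely_delete_self (M : Matroid α) (S : Set α) (e : α) :
    (M ＼ {e}).placeFreely S e = M.placeFreely S e := by
  simp [placeFreely, delete_delete]

lemma representableOver_placeFreely_of_notMem [Infinite F] [M.Finite]
    (hM : M.RepresentableOver F) (S : Set α) {e : α} (he : e ∉ M.E) :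
    (M.placeFreely S e).RepresentableOver F := by
  classical
  obtain ⟨n, v, hv⟩ := exists_represents hM
  set U := span F (v '' (S ∩ M.E)) with hU
  have hcl : ∀ X ⊆ M.E, M.closure S ⊆ M.closure X ↔ U ≤ span F (v '' X) := by
    intro X hX
    rw [← M.closure_inter_ground S, closure_subset_closure_iff_subset_closure, hU, span_le,
      image_subset_iff]
    exact forall₂_congr fun x hx ↦ hv.mem_closure_iff hX hx.2
  obtain ⟨w, hwU, hw⟩ := exists_mem_forall_mem_imp_le U
    (M.ground_finite.finite_subsets.image fun X ↦ span F (v '' X))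
  refine ⟨n, Function.update v e w, fun I hI ↦ ?_⟩
  rw [placeFreely_ground, ← sdiff_singleton_subset_iff] at hI
  have hv_eq : EqOn (Function.update v e w) v (I \ {e}) :=
    fun x hx ↦ Function.update_of_ne hx.2 _ _
  rw [placeFreely_indep_iff _ _ he, hcl _ hI, hv _ hI, ← linearIndepOn_congr hv_eq]
  by_cases heI : e ∈ I
  · conv_rhs => rw [← insert_sdiff_self_of_mem heI, linearIndepOn_insert (by simp)]
    rw [hv_eq.image_eq, Function.update_self]
    exact and_congr_right fun _ ↦ ⟨fun h h' ↦ h heI (hw _ (mem_image_of_mem _ hI) h'),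
      fun h _ h' ↦ h (h' hwU)⟩
  · simp [heI]

lemma representableOver_placeFreely [Infinite F] [M.Finite] (hM : M.RepresentableOver F)
    (S : Set α) (e : α) : (M.placeFreely S e).RepresentableOver F := by
  rw [← placeFreely_delete_self]
  exact representableOver_placeFreely_of_notMem (representableOver_delete hM {e}) S (by simp)

lemma exists_isMinor_delete_or_contract_singleton {N : Matroid α} (h : N <m M) :
    ∃ e ∈ M.E, N ≤m M ＼ {e} ∨ N ≤m M ／ {e} := by
  obtain ⟨C, D, hC, hD, -, rfl⟩ := h.isMinor.exists_eq_contract_delete_disjoint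
  rcases C.eq_empty_or_nonempty with rfl | ⟨e, he⟩
  · rcases D.eq_empty_or_nonempty with rfl | ⟨e, he⟩
    · simp [isStrictMinor_irrefl] at h
    · refine ⟨e, hD he, Or.inl ⟨∅, D, ?_⟩⟩
      rw [contract_empty, contract_empty, delete_delete, singleton_union, insert_eq_of_mem he]
  · refine ⟨e, hC he, Or.inr ⟨C, D, ?_⟩⟩
    rw [contract_contract, singleton_union, insert_eq_of_mem he]

end Representations

/-! ### Independence after free placements -/

section FreePlacement

variable {α β : Type*}

lemma placeFreely_indep_insert_iff {M : Matroid α} {S K : Set α} {e : α} (he : e ∉ M.E)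
    (hS : S ⊆ M.E) (heK : e ∉ K) :
    (M.placeFreely S e).Indep (insert e K) ↔ ∃ s ∈ S, s ∉ K ∧ M.Indep (insert s K) := by
  rw [placeFreely_indep_iff _ _ he, insert_sdiff_self_of_notMem heK,
    closure_subset_closure_iff_subset_closure]
  simp only [mem_insert_iff, true_or, true_imp_iff, not_subset]
  constructor
  · rintro ⟨hK, s, hs, hsK⟩
    exact ⟨s, hs, fun h ↦ hsK (M.subset_closure K hK.subset_ground h),
      hK.insert_indep_iff.2 (Or.inl ⟨hS hs, hsK⟩)⟩
  · rintro ⟨s, hs, hsK, h⟩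
    refine ⟨h.subset (subset_insert _ _), s, hs, ?_⟩
    simpa [insert_sdiff_self_of_notMem hsK] using h.notMem_closure_sdiff_of_mem (mem_insert s K)

lemma placeFreely_indep_iff_of_notMem {M : Matroid α} {S K : Set α} {e : α} (he : e ∉ M.E)
    (heK : e ∉ K) : (M.placeFreely S e).Indep K ↔ M.Indep K := by
  rw [placeFreely_indep_iff _ _ he, sdiff_singleton_eq_self heK]
  simp [heK]

lemma placeFreely_pair_indep_insert_iff {M : Matroid α} {x c e : α} {K D S : Set α} (he : e ∉ M.E)
    (hxc : {x, c} ⊆ M.E) (hD : D ⊆ {c}) (heK : e ∉ K ∪ D ∪ S) (hx : x ∉ K ∪ D ∪ S)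
    (hcK : c ∉ K) (hcS : c ∉ S) :
    (M.placeFreely {x, c} e).Indep (insert e (K ∪ D ∪ S)) ↔
      M.Indep (insert x K ∪ D ∪ S) ∨ D = ∅ ∧ M.Indep (K ∪ {c} ∪ S) := by
  rw [placeFreely_indep_insert_iff he hxc heK]
  simp only [mem_insert_iff, mem_singleton_iff, exists_eq_or_imp, exists_eq_left, insert_union]
  refine or_congr (and_iff_right hx) ?_
  rcases subset_singleton_iff_eq.1 hD with rfl | rfl
  · rw [union_empty, union_singleton, insert_union, and_iff_right rfl, and_iff_right]
    exact fun h ↦ h.elim hcK hcS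
  · simp

lemma placeLifts_concat (M : Matroid (Elt α β)) (c : Elt α β) (l : List β) (x : β) :
    M.placeLifts c (l ++ [x]) = (M.placeLifts c l).placeFreely {Elt.ofN x, c} (Elt.lift x) := by
  simp [placeLifts]

@[simp]
lemma placeLifts_ground (M : Matroid (Elt α β)) (c : Elt α β) (l : List β) :
    (M.placeLifts c l).E = M.E ∪ Elt.lift '' {x | x ∈ l} := by
  induction l using List.reverseRecOn with
  | nil => simp [placeLifts]
  | append_singleton l x ih =>
    rw [placeLifts_concat, placeFreely_ground, ih]
    ext y
    simp only [mem_union, mem_insert_iff, mem_image, mem_ofPred_eq, List.mem_append,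
      List.mem_singleton]
    grind

/-- The independence, in terms of `M`, of the set `K ∪ D ∪ lift '' T` of `M.placeLifts c l`, where
`D ⊆ {c}` and `c ∉ K`: all but at most one of the elements `lift x` are used as `x`, and the
remaining one as `c`, which is then not available for any other purpose. -/
def LiftsIndep (M : Matroid (Elt α β)) (c : Elt α β) (K D : Set (Elt α β)) (T : Set β) : Prop :=
  ∃ T₁ ⊆ T, ∃ C ⊆ {c}, T₁.ncard + C.ncard = T.ncard + D.ncard ∧
    M.Indep (K ∪ C ∪ Elt.ofN '' T₁)

lemma LiftsIndep.iff_of_mem {M : Matroid (Elt α β)} {c : Elt α β} {K D : Set (Elt α β)}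
    {T : Set β} {x : β} (hx : x ∈ T) (hT : T.Finite) (hD : D ⊆ {c}) :
    LiftsIndep M c K D T ↔ LiftsIndep M c (insert (Elt.ofN x) K) D (T \ {x}) ∨
      D = ∅ ∧ LiftsIndep M c K {c} (T \ {x}) := by
  have hcard := ncard_sdiff_singleton_add_one hx hT
  constructor
  · rintro ⟨T₁, hT₁, C, hC, hcard₁, h⟩
    by_cases hxT₁ : x ∈ T₁
    · have := ncard_sdiff_singleton_add_one hxT₁ (hT.subset hT₁)
      refine Or.inl ⟨T₁ \ {x}, sdiff_subset_sdiff_left hT₁, C, hC, by lia, h.subset ?_⟩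
      grind
    · have hT₁' : T₁ ⊆ T \ {x} := subset_sdiff_singleton hT₁ hxT₁
      have hT₁_le := ncard_le_ncard hT₁' hT.sdiff
      have hC_le := ncard_le_ncard hC
      rw [ncard_singleton] at hC_le
      have hD_empty : D = ∅ := by
        rw [← ncard_eq_zero ((finite_singleton c).subset hD)]
        lia
      refine Or.inr ⟨hD_empty, T₁, hT₁', C, hC, ?_, h⟩
      rw [hD_empty, ncard_empty] at hcard₁
      rw [ncard_singleton]
      lia
  · rintro (⟨T₁, hT₁, C, hC, hcard₁, h⟩ | ⟨rfl, T₁, hT₁, C, hC, hcard₁, h⟩)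
    · refine ⟨insert x T₁, insert_subset hx (hT₁.trans sdiff_subset), C, hC, ?_, ?_⟩
      · rw [ncard_insert_of_notMem (fun h ↦ (hT₁ h).2 rfl) (hT.sdiff.subset hT₁)]
        lia
      · rwa [image_insert_eq, union_insert, ← insert_union, ← insert_union]
    · refine ⟨T₁, hT₁.trans sdiff_subset, C, hC, ?_, h⟩
      rw [ncard_singleton] at hcard₁
      rw [ncard_empty]
      lia

lemma liftsIndep_empty_iff {M : Matroid (Elt α β)} {c : Elt α β} {K D : Set (Elt α β)}
    (hD : D ⊆ {c}) : LiftsIndep M c K D ∅ ↔ M.Indep (K ∪ D) := by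
  have hCD : ∀ C ⊆ {c}, C.ncard = D.ncard → C = D := by
    intro C hC hcard
    rcases subset_singleton_iff_eq.1 hC with rfl | rfl <;>
      rcases subset_singleton_iff_eq.1 hD with rfl | rfl <;> simp_all
  simp only [LiftsIndep, image_empty, union_empty, subset_empty_iff, exists_eq_left, ncard_empty,
    zero_add]
  exact ⟨fun ⟨C, hC, hcard, h⟩ ↦ hCD C hC hcard ▸ h, fun h ↦ ⟨D, hD, rfl, h⟩⟩

lemma placeLifts_indep_iff {M : Matroid (Elt α β)} {c : Elt α β} {l : List β} (hl : l.Nodup)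
    (hlN : ∀ x ∈ l, Elt.ofN x ∈ M.E) (hl_lift : ∀ x ∈ l, Elt.lift x ∉ M.E) (hc : c ∈ M.E)
    (hcN : ∀ x, c ≠ Elt.ofN x) {K D : Set (Elt α β)} {T : Set β} (hK : K ⊆ M.E) (hcK : c ∉ K)
    (hD : D ⊆ {c}) (hT : ∀ x ∈ T, x ∈ l) (hTK : ∀ x ∈ T, Elt.ofN x ∉ K) :
    (M.placeLifts c l).Indep (K ∪ D ∪ Elt.lift '' T) ↔ LiftsIndep M c K D T := by
  induction l using List.reverseRecOn generalizing K D T with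
  | nil =>
    obtain rfl : T = ∅ := eq_empty_of_forall_notMem fun x hx ↦ by simpa using hT x hx
    rw [liftsIndep_empty_iff hD, image_empty, union_empty, placeLifts, List.foldl_nil]
  | append_singleton l x ih =>
    obtain ⟨hl, -, hxl⟩ := List.nodup_append'.1 hl
    simp only [List.disjoint_singleton] at hxl
    simp only [List.mem_append, List.mem_singleton] at hlN hl_lift hT
    have ih {K D T} := ih (K := K) (D := D) (T := T) hl (fun y hy ↦ hlN y (.inl hy))
      fun y hy ↦ hl_lift y (.inl hy)
    have hx : Elt.lift x ∉ (M.placeLifts c l).E := by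
      rw [placeLifts_ground]
      rintro (h | ⟨y, hy, ⟨⟩⟩)
      exacts [hl_lift x (.inr rfl) h, hxl hy]
    have hxE : Elt.ofN x ∈ M.E := hlN x (.inr rfl)
    have hS : {Elt.ofN x, c} ⊆ (M.placeLifts c l).E := by
      rw [placeLifts_ground]
      exact (pair_subset hxE hc).trans subset_union_left
    have hxKD : Elt.lift x ∉ K ∪ D := fun h ↦
      hl_lift x (.inr rfl) (union_subset hK (hD.trans (singleton_subset_iff.2 hc)) h)
    have hcl : ∀ y, y ∈ T → c ≠ Elt.lift y := fun y hy h ↦ hl_lift y (hT y hy) (h ▸ hc)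
    rw [placeLifts_concat]
    by_cases hxT : x ∈ T
    swap
    · rw [placeFreely_indep_iff_of_notMem hx (by simpa [hxT] using hxKD),
        ih hK hcK hD (by grind) hTK]
    have hTfin : T.Finite := ((l.finite_toSet).insert x).subset fun y hy ↦ (hT y hy).symm
    have hT_eq : K ∪ D ∪ Elt.lift '' T = insert (Elt.lift x) (K ∪ D ∪ Elt.lift '' (T \ {x})) := by
      rw [← union_insert, ← image_insert_eq, insert_sdiff_self_of_mem hxT]
    rw [hT_eq, placeFreely_pair_indep_insert_iff hx hS hD (by simpa using hxKD) (by grind) hcK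
      (by grind), LiftsIndep.iff_of_mem hxT hTfin hD, ← ih (insert_subset hxE hK) (by grind) hD
      (by grind) (by grind), ← ih hK hcK subset_rfl (by grind) (by grind)]

end FreePlacement

section Apexes

variable {α β : Type*} {L : Matroid α} {p q : α} {N : Matroid β} {A : Set β}

lemma sum_mapEmbedding_indep_iff {X : Set α} {Q : Set β} :
    ((N.sum L).mapEmbedding Elt.ofSum).Indep (Elt.ofL '' X ∪ Elt.ofN '' Q) ↔
      L.Indep X ∧ N.Indep Q := by
  have h_eq : Elt.ofL '' X ∪ Elt.ofN '' Q = Elt.ofSum '' (Sum.inl '' Q ∪ Sum.inr '' X) := by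
    rw [image_union, image_image, image_image, union_comm]
    rfl
  rw [h_eq, mapEmbedding_indep_iff, preimage_image_eq _ Elt.ofSum.injective, sum_indep_iff,
    and_iff_left (image_subset_range _ _), preimage_union, preimage_union,
    preimage_image_eq _ Sum.inl_injective, preimage_image_eq _ Sum.inr_injective,
    preimage_inl_image_inr, preimage_inr_image_inl, union_empty, empty_union, and_comm]

lemma sum_mapEmbedding_ground :
    ((N.sum L).mapEmbedding Elt.ofSum).E = Elt.ofL '' L.E ∪ Elt.ofN '' N.E := by
  rw [mapEmbedding_ground_eq, sum_ground, image_union, image_image, image_image, union_comm]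
  rfl

lemma ncard_le_of_indep_of_isBase [N.RankFinite] (hA : N.IsBase A) {Q : Set β} (hQ : N.Indep Q) :
    Q.ncard ≤ A.ncard := by
  obtain ⟨B, hB, hQB⟩ := hQ.exists_isBase_superset
  rw [hA.ncard_eq_ncard_of_isBase hB]
  exact ncard_le_ncard hQB hB.finite

lemma exists_insert_indep_of_ncard_lt [N.RankFinite] (hA : N.IsBase A) {Q : Set β}
    (hQ : N.Indep Q) (hlt : Q.ncard < A.ncard) : ∃ t ∈ N.E, t ∉ Q ∧ N.Indep (insert t Q) := by
  have hlt : Q.encard < A.encard := by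
    rw [← hQ.finite.cast_ncard_eq, ← hA.finite.cast_ncard_eq]
    exact_mod_cast hlt
  obtain ⟨t, ⟨htA, htQ⟩, ht⟩ := hQ.exists_insert_of_encard_lt hA.indep hlt
  exact ⟨t, hA.subset_ground htA, htQ, ht⟩

/-- The independence of a set that consists of `X ⊆ E(L)`, `Q ⊆ E(N)` and, for each `p ∈ R`, an
element placed freely in the flat spanned by `E(N) ∪ {p}`, where `N` has rank `r`: the elements
placed for `P ⊆ R` are used as elements of `L` and the others as elements of `N`. -/
def ApexIndep (L : Matroid α) (N : Matroid β) (r : ℕ) (X : Set α) (Q : Set β) (R : Set α) : Prop :=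
  ∃ P ⊆ R, L.Indep (X ∪ P) ∧ N.Indep Q ∧ Q.ncard + R.ncard ≤ r + P.ncard

lemma apexIndep_empty_iff [N.RankFinite] (hA : N.IsBase A) {X : Set α} {Q : Set β} :
    ApexIndep L N A.ncard X Q ∅ ↔ L.Indep X ∧ N.Indep Q := by
  simp only [ApexIndep, subset_empty_iff, exists_eq_left, union_empty, ncard_empty, add_zero]
  exact and_congr_right fun _ ↦ and_iff_left_of_imp (ncard_le_of_indep_of_isBase hA)

lemma apexIndep_insert_iff [N.RankFinite] (hA : N.IsBase A) {X : Set α} {Q : Set β} {R : Set α}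
    (hR : R.Finite) (hpR : p ∉ R) :
    ApexIndep L N A.ncard X Q (insert p R) ↔
      ApexIndep L N A.ncard (insert p X) Q R ∨
      ∃ t ∈ N.E, t ∉ Q ∧ ApexIndep L N A.ncard X (insert t Q) R := by
  simp only [ApexIndep, ncard_insert_of_notMem hpR hR]
  constructor
  · rintro ⟨P, hP, hL, hQ, hcard⟩
    by_cases hpP : p ∈ P
    · have := ncard_sdiff_singleton_add_one hpP ((hR.insert p).subset hP)
      refine Or.inl ⟨P \ {p}, sdiff_singleton_subset_iff.2 hP, hL.subset ?_, hQ, by lia⟩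
      grind
    · have hPR : P ⊆ R := (subset_insert_iff_of_notMem hpP).1 hP
      have := ncard_le_ncard hPR hR
      obtain ⟨t, ht, htQ, h⟩ := exists_insert_indep_of_ncard_lt hA hQ (by lia)
      refine Or.inr ⟨t, ht, htQ, P, hPR, hL, h, ?_⟩
      rw [ncard_insert_of_notMem htQ hQ.finite]
      lia
  · rintro (⟨P, hP, hL, hQ, hcard⟩ | ⟨t, -, htQ, P, hP, hL, h, hcard⟩)
    · refine ⟨insert p P, insert_subset_insert hP, by rwa [union_insert, ← insert_union], hQ, ?_⟩
      rw [ncard_insert_of_notMem (fun h ↦ hpR (hP h)) (hR.subset hP)]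
      lia
    · have hQ := h.subset (subset_insert t Q)
      rw [ncard_insert_of_notMem htQ hQ.finite] at hcard
      exact ⟨P, hP.trans (subset_insert p R), hL, hQ, by lia⟩

lemma placeFreely_indep_union_apex_iff [N.RankFinite] (hA : N.IsBase A) {M : Matroid (Elt α β)}
    {c : Elt α β} {C K : Set (Elt α β)} {X R T : Set α} {Q : Set β} (hT : T.Finite) (hRT : R ⊆ T)
    (hpT : p ∉ T) (hM : ∀ X Q, Disjoint X T →
      (M.Indep (Elt.ofL '' X ∪ Elt.ofN '' Q ∪ K) ↔ ApexIndep L N A.ncard X Q R))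
    (hXT : Disjoint X (insert p T)) (hS : insert (Elt.ofL p) (Elt.ofN '' N.E) ⊆ M.E)
    (hcM : c ∉ M.E) (hC : C ⊆ {c}) (hc : c ∉ Elt.ofL '' X ∪ Elt.ofN '' Q ∪ K)
    (hpK : Elt.ofL p ∉ K) (hNK : ∀ t, Elt.ofN t ∉ K) :
    (M.placeFreely (insert (Elt.ofL p) (Elt.ofN '' N.E)) c).Indep
      (Elt.ofL '' X ∪ Elt.ofN '' Q ∪ K ∪ C) ↔
      ApexIndep L N A.ncard X Q (R ∪ {x | x = p ∧ c ∈ C}) := by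
  rw [disjoint_insert_right] at hXT
  rcases subset_singleton_iff_eq.1 hC with rfl | rfl
  · simp [placeFreely_indep_iff_of_notMem hcM hc, hM X Q hXT.2]
  simp only [mem_singleton_iff, and_true, ofPred_eq_eq_singleton, union_singleton]
  rw [placeFreely_indep_insert_iff hcM hS hc,
    apexIndep_insert_iff hA (hT.subset hRT) fun h ↦ hpT (hRT h),
    ← hM (insert p X) Q (disjoint_insert_left.2 ⟨hpT, hXT.2⟩)]
  simp only [exists_mem_insert, exists_mem_image]
  refine or_congr ?_ (exists_congr fun t ↦ and_congr_right fun _ ↦ and_congr ?_ ?_)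
  · rw [and_iff_right (by simp [hXT.1, hpK]), image_insert_eq, insert_union, insert_union]
  · simp [hNK]
  · rw [← hM X (insert t Q) hXT.2, image_insert_eq, union_insert, insert_union]

/-- The matroid obtained from `N ⊕ L` by freely placing `a` and `b` in the flats spanned by
`E(N) ∪ {p}` and `E(N) ∪ {q}`. -/
noncomputable def placeApexes (L : Matroid α) (p q : α) (N : Matroid β) : Matroid (Elt α β) :=
  (((N.sum L).mapEmbedding Elt.ofSum).placeFreely
    (insert (Elt.ofL p) (Elt.ofN '' N.E)) Elt.a).placeFreely
    (insert (Elt.ofL q) (Elt.ofN '' N.E)) Elt.b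

lemma placeApexes_ground :
    (placeApexes L p q N).E = {Elt.a, Elt.b} ∪ (Elt.ofL '' L.E ∪ Elt.ofN '' N.E) := by
  rw [placeApexes, placeFreely_ground, placeFreely_ground, sum_mapEmbedding_ground,
    insert_comm, insert_union, singleton_union]

lemma placeApexes_indep_iff_apexIndep [N.RankFinite] (hA : N.IsBase A) (hp : p ∈ L.E)
    (hq : q ∈ L.E) (hpq : p ≠ q) {X : Set α} {Q : Set β} (hpX : p ∉ X) (hqX : q ∉ X)
    {C D : Set (Elt α β)} (hC : C ⊆ {Elt.a}) (hD : D ⊆ {Elt.b}) :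
    (placeApexes L p q N).Indep (Elt.ofL '' X ∪ Elt.ofN '' Q ∪ C ∪ D) ↔
      ApexIndep L N A.ncard X Q ({x | x = p ∧ Elt.a ∈ C} ∪ {x | x = q ∧ Elt.b ∈ D}) := by
  set M₀ := (N.sum L).mapEmbedding (Elt.ofSum : β ⊕ α ↪ Elt α β)
  set M₁ := M₀.placeFreely (insert (Elt.ofL p) (Elt.ofN '' N.E)) Elt.a
  have hE₀ : M₀.E = _ := sum_mapEmbedding_ground
  have hE₁ : M₁.E = insert Elt.a M₀.E := placeFreely_ground ..
  have hS₀ : insert (Elt.ofL p) (Elt.ofN '' N.E) ⊆ M₀.E := by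
    rw [hE₀]
    exact insert_subset (.inl ⟨p, hp, rfl⟩) subset_union_right
  have hS₁ : insert (Elt.ofL q) (Elt.ofN '' N.E) ⊆ M₁.E := by
    rw [hE₁, hE₀]
    exact insert_subset (.inr (.inl ⟨q, hq, rfl⟩)) (subset_union_right.trans (subset_insert _ _))
  have ha₀ : Elt.a ∉ M₀.E := by
    rw [hE₀]
    simp
  have hb₁ : Elt.b ∉ M₁.E := by
    rw [hE₁, hE₀]
    simp
  refine placeFreely_indep_union_apex_iff hA (finite_singleton p) (fun x hx ↦ hx.1) hpq.symm
    (fun X Q hpX ↦ ?_) (by simp [hpX, hqX]) hS₁ hb₁ hD ?_ ?_ ?_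
  · have h₀ (X : Set α) (Q : Set β) (_ : Disjoint X ∅) :
        M₀.Indep (Elt.ofL '' X ∪ Elt.ofN '' Q ∪ ∅) ↔ ApexIndep L N A.ncard X Q ∅ := by
      rw [union_empty, apexIndep_empty_iff hA, sum_mapEmbedding_indep_iff]
    have := placeFreely_indep_union_apex_iff hA finite_empty subset_rfl (notMem_empty p) h₀
      (Q := Q) (by simpa using hpX) hS₀ ha₀ hC (by simp) (by simp) (by simp)
    simpa only [union_empty, empty_union] using this
  all_goals grind

lemma placeApexes_indep_iff [N.RankFinite] (hA : N.IsBase A) (hp : p ∈ L.E) (hq : q ∈ L.E)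
    (hpq : p ≠ q) {X : Set α} {Q : Set β} (hpX : p ∉ X) (hqX : q ∉ X) {C D : Set (Elt α β)}
    (hC : C ⊆ {Elt.a}) (hD : D ⊆ {Elt.b}) :
    (placeApexes L p q N).Indep (Elt.ofL '' X ∪ Elt.ofN '' Q ∪ C ∪ D) ↔ ∃ P ⊆ {p, q},
      (p ∈ P → C.ncard = 1) ∧ (q ∈ P → D.ncard = 1) ∧ L.Indep (X ∪ P) ∧ N.Indep Q ∧
      Q.ncard + C.ncard + D.ncard ≤ A.ncard + P.ncard := by
  have hR_card : ({x | x = p ∧ Elt.a ∈ C} ∪ {x | x = q ∧ Elt.b ∈ D}).ncard =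
      C.ncard + D.ncard := by
    rcases subset_singleton_iff_eq.1 hC with rfl | rfl <;>
      rcases subset_singleton_iff_eq.1 hD with rfl | rfl <;>
      simp [ncard_pair hpq.symm]
  have hC_mem : Elt.a ∈ C ↔ C.ncard = 1 := by
    rcases subset_singleton_iff_eq.1 hC with rfl | rfl <;> simp
  have hD_mem : Elt.b ∈ D ↔ D.ncard = 1 := by
    rcases subset_singleton_iff_eq.1 hD with rfl | rfl <;> simp
  rw [placeApexes_indep_iff_apexIndep hA hp hq hpq hpX hqX hC hD, ApexIndep, hR_card, hC_mem,
    hD_mem]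
  refine exists_congr fun P ↦ ?_
  have hP : P ⊆ {x | x = p ∧ C.ncard = 1} ∪ {x | x = q ∧ D.ncard = 1} ↔
      P ⊆ {p, q} ∧ (p ∈ P → C.ncard = 1) ∧ (q ∈ P → D.ncard = 1) := by
    constructor
    · intro h
      refine ⟨fun x hx ↦ (h hx).imp And.left And.left, fun hp ↦ ?_, fun hq ↦ ?_⟩ <;> grind
    · grind
  rw [hP, and_assoc, and_assoc, ← add_assoc]

end Apexes

/-! ### Independent sets of the construction -/

section Construction

variable {α β : Type*} {L : Matroid α} {p q : α} {N : Matroid β} {A B : Set β} {lA lB : List β}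

/-- `(A, B)` is a partition of `E(N)` into two bases of `N`, listed without repetition by `lA`
and `lB`. -/
structure BasisPartition (N : Matroid β) (A B : Set β) (lA lB : List β) : Prop where
  isBase_left : N.IsBase A
  isBase_right : N.IsBase B
  disjoint : Disjoint A B
  union_eq : A ∪ B = N.E
  nodup_left : lA.Nodup
  nodup_right : lB.Nodup
  mem_left : ∀ x, x ∈ lA ↔ x ∈ A
  mem_right : ∀ x, x ∈ lB ↔ x ∈ B

namespace BasisPartition

variable (h : BasisPartition N A B lA lB)
include h

lemma finite_left : A.Finite :=
  lA.finite_toSet.subset fun x hx ↦ (h.mem_left x).2 hx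

lemma finite_right : B.Finite :=
  lB.finite_toSet.subset fun x hx ↦ (h.mem_right x).2 hx

lemma rankFinite : N.RankFinite :=
  h.isBase_left.rankFinite_of_finite h.finite_left

lemma matroid_finite : N.Finite :=
  ⟨h.union_eq ▸ h.finite_left.union h.finite_right⟩

lemma ncard_eq : A.ncard = B.ncard :=
  have := h.rankFinite
  h.isBase_left.ncard_eq_ncard_of_isBase h.isBase_right

end BasisPartition

/-- The independence in `M(L, p, q; N, A, B)` of a set with parts `X ⊆ E(L)`, `A₀ ⊆ A` and
`B₀ ⊆ B`, where `m` (resp. `n`) is the number of its elements that belong to `A` or are equal to `a`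
(resp. belong to `B` or are equal to `b`) and `r` is the rank of `N`. The elements of `A₁` and `B₁`
are used as elements of `N`, at most one of the other `m` (resp. `n`) elements is used as `a` (resp.
`b`), and the apexes for `P` are used as elements of `L`. -/
def SplitIndep (L : Matroid α) (p q : α) (N : Matroid β) (r : ℕ) (A₀ B₀ : Set β) (X : Set α)
    (m n : ℕ) : Prop :=
  ∃ A₁ ⊆ A₀, ∃ B₁ ⊆ B₀, ∃ P ⊆ {p, q}, N.Indep (A₁ ∪ B₁) ∧ L.Indep (X ∪ P) ∧
    m ≤ A₁.ncard + 1 ∧ n ≤ B₁.ncard + 1 ∧ (p ∈ P → m = A₁.ncard + 1) ∧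
    (q ∈ P → n = B₁.ncard + 1) ∧ m + n ≤ r + P.ncard

lemma SplitIndep.symm {r : ℕ} {A₀ B₀ : Set β} {X : Set α} {m n : ℕ}
    (h : SplitIndep L p q N r A₀ B₀ X m n) : SplitIndep L q p N r B₀ A₀ X n m := by
  obtain ⟨A₁, hA₁, B₁, hB₁, P, hP, hN, hL, hm, hn, hp, hq, hmn⟩ := h
  exact ⟨B₁, hB₁, A₁, hA₁, P, pair_comm p q ▸ hP, union_comm A₁ B₁ ▸ hN, hL, hn, hm, hq, hp,
    by lia⟩

lemma splitIndep_comm {r : ℕ} {A₀ B₀ : Set β} {X : Set α} {m n : ℕ} :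
    SplitIndep L p q N r A₀ B₀ X m n ↔ SplitIndep L q p N r B₀ A₀ X n m :=
  ⟨SplitIndep.symm, SplitIndep.symm⟩

lemma exists_subset_singleton_ncard_add_eq (c : α) {i j : ℕ} (hji : j ≤ i) (hij : i ≤ j + 1) :
    ∃ C : Set α, C ⊆ {c} ∧ j + C.ncard = i := by
  obtain rfl | rfl : i = j ∨ i = j + 1 := by lia
  exacts [⟨∅, by simp, by simp⟩, ⟨{c}, subset_rfl, by simp⟩]

lemma placeLifts_placeLifts_ground (h : BasisPartition N A B lA lB) :
    (((placeApexes L p q N).placeLifts Elt.a lA).placeLifts Elt.b lB).E =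
      {Elt.a, Elt.b} ∪ (Elt.ofL '' L.E ∪ Elt.ofN '' N.E) ∪ Elt.lift '' N.E := by
  rw [placeLifts_ground, placeLifts_ground, placeApexes_ground, union_assoc, ← image_union,
    ← h.union_eq]
  simp only [h.mem_left, h.mem_right, ofPred_mem_eq]

lemma exists_placeApexes_indep_iff_splitIndep (h : BasisPartition N A B lA lB) (hp : p ∈ L.E)
    (hq : q ∈ L.E) (hpq : p ≠ q) {X : Set α} (hX : X ⊆ L.E \ {p, q}) {A₀ B₀ : Set β}
    (hA₀ : A₀ ⊆ A) (hB₀ : B₀ ⊆ B) {m n : ℕ} (hm : A₀.ncard ≤ m) (hn : B₀.ncard ≤ n) :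
    (∃ B₁ ⊆ B₀, ∃ D ⊆ {Elt.b}, B₁.ncard + D.ncard = n ∧
      ∃ A₁ ⊆ A₀, ∃ C ⊆ {Elt.a}, A₁.ncard + C.ncard = m ∧
        (placeApexes L p q N).Indep (Elt.ofL '' X ∪ Elt.ofN '' (A₁ ∪ B₁) ∪ C ∪ D)) ↔
      SplitIndep L p q N A.ncard A₀ B₀ X m n := by
  have := h.rankFinite
  have hpX : p ∉ X := fun h ↦ (hX h).2 (by simp)
  have hqX : q ∉ X := fun h ↦ (hX h).2 (by simp)
  have hcard : ∀ A₁ ⊆ A₀, ∀ B₁ ⊆ B₀, (A₁ ∪ B₁).ncard = A₁.ncard + B₁.ncard :=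
    fun A₁ hA₁ B₁ hB₁ ↦ ncard_union_eq (h.disjoint.mono (hA₁.trans hA₀) (hB₁.trans hB₀))
      (h.finite_left.subset (hA₁.trans hA₀)) (h.finite_right.subset (hB₁.trans hB₀))
  constructor
  · rintro ⟨B₁, hB₁, D, hD, hnD, A₁, hA₁, C, hC, hmC, hAB⟩
    rw [placeApexes_indep_iff h.isBase_left hp hq hpq hpX hqX hC hD] at hAB
    obtain ⟨P, hP, hpP, hqP, hL, hN, hle⟩ := hAB
    have hC_le := ncard_le_ncard hC
    have hD_le := ncard_le_ncard hD
    rw [ncard_singleton] at hC_le hD_le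
    rw [hcard A₁ hA₁ B₁ hB₁] at hle
    exact ⟨A₁, hA₁, B₁, hB₁, P, hP, hN, hL, by lia, by lia, fun h ↦ by have := hpP h; lia,
      fun h ↦ by have := hqP h; lia, by lia⟩
  · rintro ⟨A₁, hA₁, B₁, hB₁, P, hP, hN, hL, hmA₁, hnB₁, hpP, hqP, hle⟩
    have hA₁_le := ncard_le_ncard hA₁ (h.finite_left.subset hA₀)
    have hB₁_le := ncard_le_ncard hB₁ (h.finite_right.subset hB₀)
    obtain ⟨C, hC, hmC⟩ := exists_subset_singleton_ncard_add_eq Elt.a (by lia) hmA₁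
    obtain ⟨D, hD, hnD⟩ := exists_subset_singleton_ncard_add_eq Elt.b (by lia) hnB₁
    refine ⟨B₁, hB₁, D, hD, hnD, A₁, hA₁, C, hC, hmC, ?_⟩
    rw [placeApexes_indep_iff h.isBase_left hp hq hpq hpX hqX hC hD, hcard A₁ hA₁ B₁ hB₁]
    exact ⟨P, hP, fun h ↦ by have := hpP h; lia, fun h ↦ by have := hqP h; lia, hL, hN, by lia⟩

lemma placeLifts_placeLifts_indep_iff (h : BasisPartition N A B lA lB) (hp : p ∈ L.E)
    (hq : q ∈ L.E) (hpq : p ≠ q) {X : Set α} (hX : X ⊆ L.E \ {p, q}) {A₀ B₀ : Set β}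
    (hA₀ : A₀ ⊆ A) (hB₀ : B₀ ⊆ B) {C D : Set (Elt α β)} (hC : C ⊆ {Elt.a}) (hD : D ⊆ {Elt.b}) :
    (((placeApexes L p q N).placeLifts Elt.a lA).placeLifts Elt.b lB).Indep
        (Elt.ofL '' X ∪ C ∪ Elt.lift '' A₀ ∪ D ∪ Elt.lift '' B₀) ↔
      SplitIndep L p q N A.ncard A₀ B₀ X (A₀.ncard + C.ncard) (B₀.ncard + D.ncard) := by
  rw [← exists_placeApexes_indep_iff_splitIndep h hp hq hpq hX hA₀ hB₀ (Nat.le_add_right ..)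
    (Nat.le_add_right ..)]
  have hAN := h.isBase_left.subset_ground
  have hBN := h.isBase_right.subset_ground
  have hXE : X ⊆ L.E := hX.trans sdiff_subset
  have hM₁ : ((placeApexes L p q N).placeLifts Elt.a lA).E =
      {Elt.a, Elt.b} ∪ (Elt.ofL '' L.E ∪ Elt.ofN '' N.E) ∪ Elt.lift '' A := by
    simp only [placeLifts_ground, placeApexes_ground, h.mem_left, ofPred_mem_eq]
  have hM₀ : (placeApexes L p q N).E = _ := placeApexes_ground
  have hdisj : ∀ x ∈ B, x ∉ A := fun x hB hA ↦ disjoint_left.1 h.disjoint hA hB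
  rw [placeLifts_indep_iff h.nodup_right, LiftsIndep]
  · refine exists_congr fun B₁ ↦ and_congr_right fun hB₁ ↦ exists_congr fun D₁ ↦
      and_congr_right fun hD₁ ↦ and_congr_right fun _ ↦ ?_
    have h_comm : Elt.ofL '' X ∪ C ∪ Elt.lift '' A₀ ∪ D₁ ∪ Elt.ofN '' B₁ =
        (Elt.ofL '' X ∪ D₁ ∪ Elt.ofN '' B₁) ∪ C ∪ Elt.lift '' A₀ := by
      ac_rfl
    rw [h_comm, placeLifts_indep_iff h.nodup_left, LiftsIndep]
    · refine exists_congr fun A₁ ↦ and_congr_right fun _ ↦ exists_congr fun C₁ ↦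
        and_congr_right fun _ ↦ and_congr_right fun _ ↦ ?_
      have h_comm : Elt.ofL '' X ∪ D₁ ∪ Elt.ofN '' B₁ ∪ C₁ ∪ Elt.ofN '' A₁ =
          Elt.ofL '' X ∪ Elt.ofN '' (A₁ ∪ B₁) ∪ C₁ ∪ D₁ := by
        rw [image_union]
        ac_rfl
      rw [h_comm]
    all_goals grind [h.mem_left]
  all_goals grind [h.mem_right]

/-- The elements of `M(L, p, q; N, A, B)` that come from `A`, together with the new element `c`;
it is used for `(A, a)` and `(B, b)`. -/
def side (A : Set β) (c : Elt α β) : Set (Elt α β) :=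
  insert c (Elt.ofN '' A)

lemma finite_side (hA : A.Finite) (c : Elt α β) : (side A c).Finite :=
  (hA.image _).insert _

lemma ncard_side_inter (hA : A.Finite) {c : Elt α β} (hc : ∀ x, c ≠ Elt.ofN x)
    (Z : Set (Elt α β)) :
    (side A c ∩ Z).ncard = (A ∩ Elt.ofN ⁻¹' Z).ncard + (Z ∩ {c}).ncard := by
  have h_eq : side A c ∩ Z = Elt.ofN '' (A ∩ Elt.ofN ⁻¹' Z) ∪ (Z ∩ {c}) := by
    rw [image_inter_preimage, side, insert_eq, union_inter_distrib_right, union_comm,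
      inter_comm {c}]
  have hdisj : Disjoint (Elt.ofN '' (A ∩ Elt.ofN ⁻¹' Z)) (Z ∩ {c}) := by
    rw [disjoint_left]
    rintro _ ⟨x, -, rfl⟩ ⟨-, hx⟩
    exact hc x hx.symm
  rw [h_eq, ncard_union_eq hdisj ((hA.inter_of_left _).image _)
    ((finite_singleton c).inter_of_right _), ncard_image_of_injective _ fun _ _ ↦ Elt.ofN.inj]

lemma construction_ground (h : BasisPartition N A B lA lB) :
    (construction L p q N lA lB).E =
      Elt.ofL '' (L.E \ {p, q}) ∪ (side A Elt.a ∪ side B Elt.b) := by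
  have h_ground : (construction₁ L p q N lA lB).E = _ := placeLifts_placeLifts_ground h
  rw [construction, delete_ground, construction₂, mapEquiv_ground_eq, delete_ground, h_ground]
  ext x
  simp only [mem_sdiff, mem_image_equiv, side, ← h.union_eq]
  rcases x with x | x | _ | _ | x
  · simp [Elt.swapLift]
  · simp [Elt.swapLift]
  · simp [Elt.swapLift]
  · simp [Elt.swapLift]
  · simpa [Elt.swapLift] using Or.resolve_left

lemma construction_finite (hL : L.Finite) (h : BasisPartition N A B lA lB) :
    (construction L p q N lA lB).Finite :=
  ⟨by
    rw [construction_ground h]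
    exact ((hL.ground_finite.subset sdiff_subset).image _).union
      ((finite_side h.finite_left _).union (finite_side h.finite_right _))⟩

lemma ofL_preimage_subset (h : BasisPartition N A B lA lB) {Z : Set (Elt α β)}
    (hZ : Z ⊆ (construction L p q N lA lB).E) : Elt.ofL ⁻¹' Z ⊆ L.E \ {p, q} := fun x hx ↦ by
  simpa [construction_ground h, side] using hZ hx

lemma swapLift_symm_image_eq (h : BasisPartition N A B lA lB) {Z : Set (Elt α β)}
    (hZ : Z ⊆ (construction L p q N lA lB).E) :
    Elt.swapLift.symm '' Z = Elt.ofL '' (Elt.ofL ⁻¹' Z) ∪ (Z ∩ {Elt.a}) ∪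
      Elt.lift '' (A ∩ Elt.ofN ⁻¹' Z) ∪ (Z ∩ {Elt.b}) ∪ Elt.lift '' (B ∩ Elt.ofN ⁻¹' Z) := by
  rw [construction_ground h] at hZ
  ext x
  rw [mem_image_equiv, Equiv.symm_symm]
  rcases x with x | x | _ | _ | x
  · simp [Elt.swapLift]
  · simpa [Elt.swapLift] using fun h ↦ by simpa [side] using hZ h
  · simp [Elt.swapLift]
  · simp [Elt.swapLift]
  · have hx : Elt.ofN x ∈ Z → x ∈ A ∪ B := fun h ↦ by simpa [side] using hZ h
    rw [mem_union] at hx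
    have : (Elt.ofN x ∈ Z) ↔ x ∈ A ∧ Elt.ofN x ∈ Z ∨ x ∈ B ∧ Elt.ofN x ∈ Z := by tauto
    simpa [Elt.swapLift] using this

lemma construction_indep_iff (h : BasisPartition N A B lA lB) (hp : p ∈ L.E) (hq : q ∈ L.E)
    (hpq : p ≠ q) {Z : Set (Elt α β)} (hZ : Z ⊆ (construction L p q N lA lB).E) :
    (construction L p q N lA lB).Indep Z ↔
      SplitIndep L p q N A.ncard (A ∩ Elt.ofN ⁻¹' Z) (B ∩ Elt.ofN ⁻¹' Z) (Elt.ofL ⁻¹' Z)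
        (side A Elt.a ∩ Z).ncard (side B Elt.b ∩ Z).ncard := by
  have hX := ofL_preimage_subset h hZ
  rw [ncard_side_inter h.finite_left (by simp), ncard_side_inter h.finite_right (by simp),
    ← placeLifts_placeLifts_indep_iff h hp hq hpq hX inter_subset_left inter_subset_left
    inter_subset_right inter_subset_right, ← swapLift_symm_image_eq h hZ, construction,
    delete_indep_iff, construction₂, mapEquiv_indep_iff, delete_indep_iff]
  rw [and_iff_left, and_iff_left]
  · rfl
  · rw [disjoint_left]
    rintro _ ⟨x, hx, rfl⟩ ⟨y, -, hy⟩
    obtain rfl : Elt.lift y = x := (Equiv.eq_symm_apply _).1 hy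
    simpa [construction_ground h, side] using hZ hx
  · rw [disjoint_left]
    rintro _ hx (rfl | rfl)
    exacts [(hX hx).2 (.inl rfl), (hX hx).2 (.inr rfl)]

end Construction

section SplitIndep

variable {α β : Type*} {L : Matroid α} {p q : α} {N : Matroid β} {A : Set β} {X : Set α}

lemma SplitIndep.add_le {r : ℕ} {A₀ B₀ : Set β} {m n : ℕ}
    (h : SplitIndep L p q N r A₀ B₀ X m n) : m + n ≤ r + 2 := by
  obtain ⟨A₁, -, B₁, -, P, hP, -, -, -, -, -, -, hle⟩ := h
  have hP_le := (ncard_le_ncard hP).trans (ncard_insert_le p {q})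
  rw [ncard_singleton] at hP_le
  lia

lemma splitIndep_empty_empty_iff {r : ℕ} :
    SplitIndep L p q N r ∅ ∅ X 0 0 ↔ L.Indep X := by
  refine ⟨?_, fun hX ↦ ⟨∅, subset_rfl, ∅, subset_rfl, ∅, by simp, by simp, by simpa, by simp⟩⟩
  rintro ⟨A₁, -, B₁, -, P, -, -, hL, -⟩
  exact hL.subset subset_union_left

lemma splitIndep_of_indep (hA : N.Indep A) (hX : L.Indep X) :
    SplitIndep L p q N A.ncard A ∅ X A.ncard 0 :=
  ⟨A, subset_rfl, ∅, subset_rfl, ∅, by simp, by simpa, by simpa, by simp⟩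

lemma splitIndep_succ_zero_iff (hA : N.Indep A) (hpq : p ≠ q) :
    SplitIndep L p q N A.ncard A ∅ X (A.ncard + 1) 0 ↔ L.Indep (insert p X) := by
  constructor
  · rintro ⟨A₁, -, B₁, -, P, hP, -, hL, -, -, -, hqP, hle⟩
    obtain ⟨x, hxP⟩ := nonempty_of_ncard_ne_zero (s := P) (by lia)
    obtain rfl : x = p := (hP hxP).resolve_right <| by
      rintro rfl
      simpa using hqP hxP
    exact hL.subset (insert_subset (.inr hxP) subset_union_left)
  · intro hX
    exact ⟨A, subset_rfl, ∅, subset_rfl, {p}, by simp, by simpa, by simpa, by simp [hpq.symm]⟩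

lemma splitIndep_succ_one_iff (hA : N.Indep A) (hpq : p ≠ q) :
    SplitIndep L p q N A.ncard A ∅ X (A.ncard + 1) 1 ↔ L.Indep (insert p (insert q X)) := by
  constructor
  · rintro ⟨A₁, -, B₁, -, P, hP, -, hL, -, -, -, -, hle⟩
    obtain rfl : P = {p, q} :=
      eq_of_subset_of_ncard_le hP (by rw [ncard_pair hpq]; lia) (toFinite _)
    simpa [union_insert] using hL
  · intro hX
    refine ⟨A, subset_rfl, ∅, subset_rfl, {p, q}, subset_rfl, by simpa, ?_, ?_⟩
    · simpa [union_insert] using hX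
    · simp [ncard_pair hpq]

end SplitIndep

section ConstructionIndep

variable {α β : Type*} {L : Matroid α} {p q : α} {N : Matroid β} {A B : Set β} {lA lB : List β}
  {X : Set α}

lemma construction_indep_union_iff (h : BasisPartition N A B lA lB) (hp : p ∈ L.E) (hq : q ∈ L.E)
    (hpq : p ≠ q) (hX : X ⊆ L.E \ {p, q}) {T : Set (Elt α β)}
    (hT : T ⊆ side A Elt.a ∪ side B Elt.b) :
    (construction L p q N lA lB).Indep (Elt.ofL '' X ∪ T) ↔
      SplitIndep L p q N A.ncard (A ∩ Elt.ofN ⁻¹' T) (B ∩ Elt.ofN ⁻¹' T) X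
        (side A Elt.a ∩ T).ncard (side B Elt.b ∩ T).ncard := by
  have hZ : Elt.ofL '' X ∪ T ⊆ (construction L p q N lA lB).E := by
    rw [construction_ground h]
    exact union_subset_union (image_mono hX) hT
  have hN : (Elt.ofN ⁻¹' (Elt.ofL '' X) : Set β) = ∅ := by
    ext
    simp
  have hL : Elt.ofL ⁻¹' T = ∅ := eq_empty_of_forall_notMem fun x hx ↦ by
    simpa [side] using hT hx
  have h_side : ∀ (C : Set β) (c : Elt α β), (∀ x, c ≠ Elt.ofL x) →
      side C c ∩ (Elt.ofL '' X ∪ T) = side C c ∩ T := by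
    intro C c hc
    rw [inter_union_distrib_left, union_eq_right]
    rintro _ ⟨hx, x, -, rfl⟩
    simp [side, (hc x).symm] at hx
  rw [construction_indep_iff h hp hq hpq hZ, preimage_union, preimage_union, hN, hL,
    empty_union, union_empty, preimage_image_eq _ fun _ _ ↦ Elt.ofL.inj, h_side _ _ (by simp),
    h_side _ _ (by simp)]

lemma construction_indep_ofL_image_iff (h : BasisPartition N A B lA lB) (hp : p ∈ L.E)
    (hq : q ∈ L.E) (hpq : p ≠ q) (hX : X ⊆ L.E \ {p, q}) :
    (construction L p q N lA lB).Indep (Elt.ofL '' X) ↔ L.Indep X := by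
  have := construction_indep_union_iff h hp hq hpq hX (empty_subset _)
  simpa [splitIndep_empty_empty_iff] using this

lemma ofN_preimage_side (c : Elt α β) (hc : ∀ x, c ≠ Elt.ofN x) (A : Set β) :
    (Elt.ofN ⁻¹' side A c : Set β) = A := by
  ext x
  simp [side, (hc x).symm]

lemma ncard_side (hA : A.Finite) {c : Elt α β} (hc : ∀ x, c ≠ Elt.ofN x) :
    (side A c).ncard = A.ncard + 1 := by
  rw [side, ncard_insert_of_notMem (by simp [(hc _).symm]) (hA.image _),
    ncard_image_of_injective _ fun _ _ ↦ Elt.ofN.inj]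

lemma ncard_side_inter_le_or (hA : A.Finite) {c : Elt α β} (hc : ∀ x, c ≠ Elt.ofN x)
    {T Z : Set (Elt α β)} (hT : T.Finite) (hZ : side A c ⊆ Z → (T ∩ Z).Nonempty) :
    (side A c ∩ Z).ncard ≤ A.ncard ∨ 1 ≤ (T ∩ Z).ncard := by
  by_cases hAZ : side A c ⊆ Z
  · exact .inr ((ncard_pos (hT.inter_of_left Z)).2 (hZ hAZ))
  · have h_lt := ncard_lt_ncard (inter_ssubset_left_iff.2 hAZ) (finite_side hA c)
    rw [ncard_side hA hc] at h_lt
    exact .inl (Nat.le_of_lt_succ h_lt)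

lemma BasisPartition.disjoint_side (h : BasisPartition N A B lA lB) :
    Disjoint (side A Elt.a : Set (Elt α β)) (side B Elt.b) := by
  have := disjoint_left.1 h.disjoint
  rw [disjoint_left]
  rintro _ (rfl | ⟨x, hx, rfl⟩)
  · simp [side]
  · simpa [side] using this hx

section Sides

variable (h : BasisPartition N A B lA lB) (hp : p ∈ L.E) (hq : q ∈ L.E) (hpq : p ≠ q)
  (hX : X ⊆ L.E \ {p, q})
include h hp hq hpq hX

lemma construction_indep_union_ofN_image (hLX : L.Indep X) :
    (construction L p q N lA lB).Indep (Elt.ofL '' X ∪ Elt.ofN '' A) := by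
  have hA_inter : side A Elt.a ∩ (Elt.ofN '' A : Set (Elt α β)) = Elt.ofN '' A :=
    inter_eq_right.2 (subset_insert _ _)
  have hB_inter : side B Elt.b ∩ (Elt.ofN '' A : Set (Elt α β)) = ∅ :=
    (h.disjoint_side.mono_left (subset_insert _ _)).symm.inter_eq
  have hinj : Function.Injective (Elt.ofN : β → Elt α β) := fun _ _ ↦ Elt.ofN.inj
  rw [construction_indep_union_iff h hp hq hpq hX ((subset_insert _ _).trans subset_union_left),
    preimage_image_eq _ hinj, inter_self, h.disjoint.symm.inter_eq, hA_inter, hB_inter,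
    ncard_image_of_injective _ hinj, ncard_empty]
  exact splitIndep_of_indep h.isBase_left.indep hLX

lemma construction_indep_union_side_left_iff :
    (construction L p q N lA lB).Indep (Elt.ofL '' X ∪ side A Elt.a) ↔ L.Indep (insert p X) := by
  rw [construction_indep_union_iff h hp hq hpq hX subset_union_left,
    ofN_preimage_side _ (by simp), inter_self, inter_self, h.disjoint.symm.inter_eq,
    h.disjoint_side.symm.inter_eq, ncard_side h.finite_left (by simp), ncard_empty,
    splitIndep_succ_zero_iff h.isBase_left.indep hpq]

lemma construction_indep_union_side_right_iff :
    (construction L p q N lA lB).Indep (Elt.ofL '' X ∪ side B Elt.b) ↔ L.Indep (insert q X) := by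
  rw [construction_indep_union_iff h hp hq hpq hX subset_union_right,
    ofN_preimage_side _ (by simp), inter_self, inter_self, h.disjoint.inter_eq,
    h.disjoint_side.inter_eq, ncard_side h.finite_right (by simp), ncard_empty,
    splitIndep_comm, h.ncard_eq, splitIndep_succ_zero_iff h.isBase_right.indep hpq.symm]

lemma construction_indep_union_insert_side_left_iff :
    (construction L p q N lA lB).Indep (Elt.ofL '' X ∪ insert Elt.b (side A Elt.a)) ↔
      L.Indep (insert p (insert q X)) := by
  have hN : (Elt.ofN ⁻¹' insert Elt.b (side A Elt.a : Set (Elt α β)) : Set β) = A := by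
    ext
    simp [side]
  have hB_inter : side B Elt.b ∩ insert Elt.b (side A Elt.a : Set (Elt α β)) = {Elt.b} := by
    rw [inter_insert_of_mem (show Elt.b ∈ side B Elt.b from .inl rfl),
      h.disjoint_side.symm.inter_eq, insert_empty_eq]
  rw [construction_indep_union_iff h hp hq hpq hX
    (insert_subset (.inr (.inl rfl)) subset_union_left),
    hN, hB_inter, inter_self, inter_eq_left.2 (subset_insert _ _), h.disjoint.symm.inter_eq,
    ncard_side h.finite_left (by simp), ncard_singleton,
    splitIndep_succ_one_iff h.isBase_left.indep hpq]

lemma construction_indep_union_insert_side_right_iff :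
    (construction L p q N lA lB).Indep (Elt.ofL '' X ∪ insert Elt.a (side B Elt.b)) ↔
      L.Indep (insert q (insert p X)) := by
  have hN : (Elt.ofN ⁻¹' insert Elt.a (side B Elt.b : Set (Elt α β)) : Set β) = B := by
    ext
    simp [side]
  have hA_inter : side A Elt.a ∩ insert Elt.a (side B Elt.b : Set (Elt α β)) = {Elt.a} := by
    rw [inter_insert_of_mem (show Elt.a ∈ side A Elt.a from .inl rfl),
      h.disjoint_side.inter_eq, insert_empty_eq]
  rw [construction_indep_union_iff h hp hq hpq hX
    (insert_subset (.inl (.inl rfl)) subset_union_right),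
    hN, hA_inter, inter_self, inter_eq_left.2 (subset_insert _ _), h.disjoint.inter_eq,
    ncard_side h.finite_right (by simp), ncard_singleton, splitIndep_comm, h.ncard_eq,
    splitIndep_succ_one_iff h.isBase_right.indep hpq.symm]

end Sides

lemma ncard_le_of_construction_indep (h : BasisPartition N A B lA lB) (hp : p ∈ L.E)
    (hq : q ∈ L.E) (hpq : p ≠ q) {T : Set (Elt α β)} (hT : T ⊆ side A Elt.a ∪ side B Elt.b)
    (hTi : (construction L p q N lA lB).Indep T) : T.ncard ≤ A.ncard + 2 := by
  have hfin : T.Finite :=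
    ((finite_side h.finite_left _).union (finite_side h.finite_right _)).subset hT
  have h_le := ((construction_indep_iff h hp hq hpq hTi.subset_ground).1 hTi).add_le
  rwa [← ncard_union_eq (h.disjoint_side.mono inter_subset_left inter_subset_left)
    (hfin.inter_of_right _) (hfin.inter_of_right _), ← union_inter_distrib_right,
    inter_eq_right.2 hT] at h_le

lemma union_side_subset_closure (h : BasisPartition N A B lA lB) (hp : p ∈ L.E) (hq : q ∈ L.E)
    (hpq : p ≠ q) {T : Set (Elt α β)} (hT : T ⊆ side A Elt.a ∪ side B Elt.b)
    (hTi : (construction L p q N lA lB).Indep T) (hT_card : A.ncard + 2 ≤ T.ncard) :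
    side A Elt.a ∪ side B Elt.b ⊆ (construction L p q N lA lB).closure T := by
  intro e he
  by_contra he_cl
  have heT : e ∉ T := fun heT ↦ he_cl (mem_closure_of_mem _ heT)
  have heE : e ∈ (construction L p q N lA lB).E := by
    rw [construction_ground h]
    exact .inr he
  have h_le := ncard_le_of_construction_indep h hp hq hpq (insert_subset he hT)
    (hTi.insert_indep_iff.2 (.inl ⟨heE, he_cl⟩))
  rw [ncard_insert_of_notMem heT (finite_of_ncard_pos (by lia))] at h_le
  lia

end ConstructionIndep

/-! ### Proper minors -/

section MoveTowards

variable {α β : Type*} {L : Matroid α} {p q : α} {N : Matroid β} {X : Set α}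

lemma injective_update_some_none [DecidableEq α] (p : α) :
    Function.Injective (Function.update some p none : α → Option α) := by
  intro x y h
  by_cases hx : x = p <;> by_cases hy : y = p <;> simp_all

lemma update_some_none_image_eq [DecidableEq α] (hpX : p ∉ X) :
    Function.update some p none '' X = some '' X :=
  image_congr fun _ hx ↦ Function.update_of_ne (ne_of_mem_of_not_mem hx hpX) _ _

lemma mapEmbedding_some_indep_image_iff :
    (L.mapEmbedding Function.Embedding.some).Indep (some '' X) ↔ L.Indep X := by
  rw [mapEmbedding_indep_iff, and_iff_left (by simp), Function.Embedding.some_apply,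
    preimage_image_eq _ (Option.some_injective α)]

lemma moveTowards_indep_iff_of_notMem (hpX : p ∉ X) :
    (L.moveTowards p q).Indep X ↔ L.Indep X := by
  classical
  rw [moveTowards, comap_indep_iff, delete_indep_iff, update_some_none_image_eq hpX,
    and_iff_left (injective_update_some_none p).injOn, and_iff_left (by simpa using hpX),
    placeFreely_indep_iff_of_notMem (by simp) (by simp), mapEmbedding_some_indep_image_iff]

lemma moveTowards_indep_insert_iff (hp : p ∈ L.E) (hq : q ∈ L.E) (hpX : p ∉ X) :
    (L.moveTowards p q).Indep (insert p X) ↔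
      L.Indep (insert p X) ∨ (q ∉ X ∧ L.Indep (insert q X)) := by
  classical
  rw [moveTowards, comap_indep_iff, delete_indep_iff, image_insert_eq, Function.update_self,
    update_some_none_image_eq hpX, and_iff_left (injective_update_some_none p).injOn,
    and_iff_left (by simpa using hpX),
    placeFreely_indep_insert_iff (by simp) (by simp [pair_subset_iff, hp, hq]) (by simp)]
  simp only [mem_insert_iff, mem_singleton_iff, exists_eq_or_imp, exists_eq_left,
    ← image_insert_eq, mapEmbedding_some_indep_image_iff,
    (Option.some_injective α).mem_set_image, hpX, not_false_eq_true, true_and]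

lemma moveTowards_indep_union_iff (hp : p ∈ L.E) (hq : q ∈ L.E) (hpq : p ≠ q) (hpX : p ∉ X)
    (hqX : q ∉ X) {P : Set α} (hP : P ⊆ {p, q}) :
    (L.moveTowards p q).Indep (X ∪ P) ↔
      L.Indep (X ∪ P) ∨ (P = {p} ∧ L.Indep (insert q X)) := by
  obtain rfl | rfl | rfl | rfl := subset_pair_iff_eq.1 hP
  · simp [moveTowards_indep_iff_of_notMem hpX]
  · simp [moveTowards_indep_insert_iff hp hq hpX, hqX]
  · simp [moveTowards_indep_iff_of_notMem (show p ∉ insert q X by simp [hpq, hpX]), hpq.symm]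
  · have hpqX : p ∉ insert q X := by simp [hpq, hpX]
    rw [union_insert, union_singleton, moveTowards_indep_insert_iff hp hq hpqX]
    simp [Set.ext_iff, hpq.symm]

/-- In the construction, `m ≤ r ∨ 1 ≤ n` fails only for the sets that contain all of `side A a` and
no element of `side B b`. -/
lemma splitIndep_moveTowards_iff (hp : p ∈ L.E) (hq : q ∈ L.E) (hpq : p ≠ q) (hpX : p ∉ X)
    (hqX : q ∉ X) {A₀ B₀ : Set β} {r m n : ℕ} (hmn : m ≤ r ∨ 1 ≤ n) :
    SplitIndep (L.moveTowards p q) p q N r A₀ B₀ X m n ↔ SplitIndep L p q N r A₀ B₀ X m n := by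
  constructor
  · rintro ⟨A₁, hA₁, B₁, hB₁, P, hP, hN, hL, hm, hn, hpP, hqP, hle⟩
    rw [moveTowards_indep_union_iff hp hq hpq hpX hqX hP] at hL
    obtain hL | ⟨rfl, hL⟩ := hL
    · exact ⟨A₁, hA₁, B₁, hB₁, P, hP, hN, hL, hm, hn, hpP, hqP, hle⟩
    rw [ncard_singleton] at hle
    have hmA₁ := hpP rfl
    obtain rfl | hn_pos := n.eq_zero_or_pos
    · exact ⟨A₁, hA₁, B₁, hB₁, ∅, empty_subset _, hN, by simpa using hL.subset (subset_insert q X),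
        hm, hn, by simp, by simp, by simpa using hmn⟩
    · obtain ⟨B₂, hB₂, hnB₂⟩ := exists_subset_card_eq (s := B₁) (n := n - 1) (by lia)
      exact ⟨A₁, hA₁, B₂, hB₂.trans hB₁, {q}, by simp,
        hN.subset (union_subset_union_right _ hB₂), by rwa [union_singleton], hm, by lia,
        fun _ ↦ hmA₁, fun _ ↦ by lia, by rwa [ncard_singleton]⟩
  · rintro ⟨A₁, hA₁, B₁, hB₁, P, hP, hN, hL, h⟩
    exact ⟨A₁, hA₁, B₁, hB₁, P, hP, hN,
      (moveTowards_indep_union_iff hp hq hpq hpX hqX hP).2 (.inl hL), h⟩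

end MoveTowards

section Minors

variable {α β : Type*} {L : Matroid α} {p q : α} {N : Matroid β} {A B : Set β} {lA lB : List β}

lemma splitIndep_delete_iff {x : α} (hxp : x ≠ p) (hxq : x ≠ q) {X : Set α} (hxX : x ∉ X)
    {A₀ B₀ : Set β} {r m n : ℕ} :
    SplitIndep (L ＼ {x}) p q N r A₀ B₀ X m n ↔ SplitIndep L p q N r A₀ B₀ X m n := by
  refine exists_congr fun A₁ ↦ and_congr_right fun _ ↦ exists_congr fun B₁ ↦
    and_congr_right fun _ ↦ exists_congr fun P ↦ and_congr_right fun hP ↦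
    and_congr_right fun _ ↦ and_congr_left fun _ ↦ ?_
  have hxP : x ∉ P := fun hx ↦ (hP hx).elim hxp hxq
  rw [deleteElem_indep_iff, and_iff_left (by simp [hxX, hxP])]

lemma splitIndep_contract_iff {x : α} (hx : L.IsNonloop x) (hxp : x ≠ p) (hxq : x ≠ q) {X : Set α}
    (hxX : x ∉ X) {A₀ B₀ : Set β} {r m n : ℕ} :
    SplitIndep (L ／ {x}) p q N r A₀ B₀ X m n ↔
      SplitIndep L p q N r A₀ B₀ (insert x X) m n := by
  refine exists_congr fun A₁ ↦ and_congr_right fun _ ↦ exists_congr fun B₁ ↦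
    and_congr_right fun _ ↦ exists_congr fun P ↦ and_congr_right fun hP ↦
    and_congr_right fun _ ↦ and_congr_left fun _ ↦ ?_
  have hxP : x ∉ P := fun hx ↦ (hP hx).elim hxp hxq
  rw [hx.contractElem_indep_iff, and_iff_right (by simp [hxX, hxP]), insert_union]

lemma delete_singleton_isStrictMinor {M : Matroid α} {e : α} (he : e ∈ M.E) : M ＼ {e} <m M :=
  isStrictMinor_iff_isMinor_ssubset.2 ⟨⟨∅, {e}, by simp⟩, by simpa using he⟩

lemma contract_singleton_isStrictMinor {M : Matroid α} {e : α} (he : e ∈ M.E) : M ／ {e} <m M :=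
  isStrictMinor_iff_isMinor_ssubset.2 ⟨⟨{e}, ∅, by simp⟩, by simpa using he⟩

lemma delete_singleton_eq_of_indep_iff {M M' : Matroid α} {e : α} (hE : M.E = M'.E)
    (h : ∀ I ⊆ M.E, e ∉ I → (M.Indep I ↔ M'.Indep I)) : M ＼ {e} = M' ＼ {e} := by
  refine ext_indep (by simp [hE]) fun I hI ↦ ?_
  obtain ⟨hIE, heI⟩ := subset_sdiff.1 hI
  rw [disjoint_singleton_right] at heI
  rw [deleteElem_indep_iff, deleteElem_indep_iff, h I hIE heI]

lemma contract_singleton_eq_of_indep_iff {M M' : Matroid α} {e : α} (hE : M.E = M'.E)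
    (he : M.IsNonloop e) (h : ∀ I ⊆ M.E, e ∈ I → (M.Indep I ↔ M'.Indep I)) :
    M ／ {e} = M' ／ {e} := by
  have he' : M'.IsNonloop e := by
    rw [← indep_singleton] at he ⊢
    exact (h {e} he.subset_ground rfl).1 he
  refine ext_indep (by simp [hE]) fun I hI ↦ ?_
  rw [he.contractElem_indep_iff, he'.contractElem_indep_iff,
    h _ (insert_subset he.mem_ground (hI.trans sdiff_subset)) (mem_insert e I)]

end Minors

section ConstructionMinors

variable {α β : Type*} {L : Matroid α} {p q : α} {N : Matroid β} {A B : Set β} {lA lB : List β}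

lemma construction_delete_ofL (h : BasisPartition N A B lA lB) (hp : p ∈ L.E) (hq : q ∈ L.E)
    (hpq : p ≠ q) {x : α} (hxp : x ≠ p) (hxq : x ≠ q) :
    construction L p q N lA lB ＼ {Elt.ofL x} = construction (L ＼ {x}) p q N lA lB := by
  have hE : (construction L p q N lA lB ＼ {Elt.ofL x}).E =
      (construction (L ＼ {x}) p q N lA lB).E := by
    simp only [delete_ground, construction_ground h]
    grind [side]
  refine ext_indep hE fun I hI ↦ ?_
  obtain ⟨hIE, hxI⟩ := subset_sdiff.1 hI
  rw [disjoint_singleton_right] at hxI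
  rw [deleteElem_indep_iff, and_iff_left hxI, construction_indep_iff h hp hq hpq hIE,
    construction_indep_iff h (by simp [hp, hxp.symm]) (by simp [hq, hxq.symm]) hpq (hE ▸ hI),
    splitIndep_delete_iff hxp hxq hxI]

lemma construction_isNonloop_ofL_iff (h : BasisPartition N A B lA lB) (hp : p ∈ L.E) (hq : q ∈ L.E)
    (hpq : p ≠ q) {x : α} (hx : x ∈ L.E \ {p, q}) :
    (construction L p q N lA lB).IsNonloop (Elt.ofL x) ↔ L.IsNonloop x := by
  rw [← indep_singleton, ← image_singleton,
    construction_indep_ofL_image_iff h hp hq hpq (singleton_subset_iff.2 hx), indep_singleton]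

lemma construction_contract_ofL (h : BasisPartition N A B lA lB) (hp : p ∈ L.E) (hq : q ∈ L.E)
    (hpq : p ≠ q) {x : α} (hx : L.IsNonloop x) (hxp : x ≠ p) (hxq : x ≠ q) :
    construction L p q N lA lB ／ {Elt.ofL x} = construction (L ／ {x}) p q N lA lB := by
  have hE : (construction L p q N lA lB ／ {Elt.ofL x}).E =
      (construction (L ／ {x}) p q N lA lB).E := by
    simp only [contract_ground, construction_ground h]
    grind [side]
  have hx' := (construction_isNonloop_ofL_iff h hp hq hpq ⟨hx.mem_ground, by simp [*]⟩).2 hx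
  refine ext_indep hE fun I hI ↦ ?_
  obtain ⟨hIE, hxI⟩ := subset_sdiff.1 hI
  rw [disjoint_singleton_right] at hxI
  have hN : (Elt.ofN ⁻¹' insert (Elt.ofL x) I : Set β) = Elt.ofN ⁻¹' I := by
    ext
    simp
  have hL : Elt.ofL ⁻¹' insert (Elt.ofL x) I = insert x (Elt.ofL ⁻¹' I) := by
    ext
    simp
  rw [hx'.contractElem_indep_iff, and_iff_right hxI,
    construction_indep_iff h hp hq hpq (insert_subset hx'.mem_ground hIE),
    construction_indep_iff h (by simp [hp, hxp.symm]) (by simp [hq, hxq.symm]) hpq (hE ▸ hI),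
    splitIndep_contract_iff hx hxp hxq hxI, hN, hL,
    inter_insert_of_notMem (by simp [side]), inter_insert_of_notMem (by simp [side])]

lemma construction_ground_congr (h : BasisPartition N A B lA lB) {L' : Matroid α}
    (hE : L'.E = L.E) : (construction L' p q N lA lB).E = (construction L p q N lA lB).E := by
  rw [construction_ground h, construction_ground h, hE]

section MoveTowards

variable (h : BasisPartition N A B lA lB) (hp : p ∈ L.E) (hq : q ∈ L.E) (hpq : p ≠ q)
  {Z : Set (Elt α β)} (hZ : Z ⊆ (construction L p q N lA lB).E)
include h hp hq hpq hZ

lemma construction_moveTowards_left_indep_iff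
    (hZ_side : side A Elt.a ⊆ Z → (side B Elt.b ∩ Z).Nonempty) :
    (construction (L.moveTowards p q) p q N lA lB).Indep Z ↔
      (construction L p q N lA lB).Indep Z := by
  have hX := ofL_preimage_subset h hZ
  have hE : (L.moveTowards p q).E = L.E := moveTowards_ground L hp
  rw [construction_indep_iff h (hE ▸ hp) (hE ▸ hq) hpq (by rwa [construction_ground_congr h hE]),
    construction_indep_iff h hp hq hpq hZ]
  exact splitIndep_moveTowards_iff hp hq hpq (fun hpX ↦ (hX hpX).2 (.inl rfl))
    (fun hqX ↦ (hX hqX).2 (.inr rfl))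
    (ncard_side_inter_le_or h.finite_left (by simp) (finite_side h.finite_right _) hZ_side)

lemma construction_moveTowards_right_indep_iff
    (hZ_side : side B Elt.b ⊆ Z → (side A Elt.a ∩ Z).Nonempty) :
    (construction (L.moveTowards q p) p q N lA lB).Indep Z ↔
      (construction L p q N lA lB).Indep Z := by
  have hX := ofL_preimage_subset h hZ
  have hE : (L.moveTowards q p).E = L.E := moveTowards_ground L hq
  rw [construction_indep_iff h (hE ▸ hp) (hE ▸ hq) hpq (by rwa [construction_ground_congr h hE]),
    construction_indep_iff h hp hq hpq hZ, splitIndep_comm, splitIndep_comm (L := L), h.ncard_eq]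
  exact splitIndep_moveTowards_iff hq hp hpq.symm (fun hqX ↦ (hX hqX).2 (.inr rfl))
    (fun hpX ↦ (hX hpX).2 (.inl rfl))
    (ncard_side_inter_le_or h.finite_right (by simp) (finite_side h.finite_left _) hZ_side)

end MoveTowards

lemma construction_moveTowards_left_delete (h : BasisPartition N A B lA lB) (hp : p ∈ L.E)
    (hq : q ∈ L.E) (hpq : p ≠ q) {e : Elt α β} (he : e ∈ side A Elt.a) :
    construction (L.moveTowards p q) p q N lA lB ＼ {e} = construction L p q N lA lB ＼ {e} :=
  delete_singleton_eq_of_indep_iff (construction_ground_congr h (moveTowards_ground L hp))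
    fun _ hI heI ↦ construction_moveTowards_left_indep_iff h hp hq hpq
      (construction_ground_congr h (moveTowards_ground L hp) ▸ hI) fun h_sub ↦ (heI (h_sub he)).elim

lemma construction_moveTowards_right_delete (h : BasisPartition N A B lA lB) (hp : p ∈ L.E)
    (hq : q ∈ L.E) (hpq : p ≠ q) {e : Elt α β} (he : e ∈ side B Elt.b) :
    construction (L.moveTowards q p) p q N lA lB ＼ {e} = construction L p q N lA lB ＼ {e} :=
  delete_singleton_eq_of_indep_iff (construction_ground_congr h (moveTowards_ground L hq))
    fun _ hI heI ↦ construction_moveTowards_right_indep_iff h hp hq hpq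
      (construction_ground_congr h (moveTowards_ground L hq) ▸ hI) fun h_sub ↦ (heI (h_sub he)).elim

lemma construction_moveTowards_left_contract (h : BasisPartition N A B lA lB) (hp : p ∈ L.E)
    (hq : L.IsNonloop q) (hpq : p ≠ q) {e : Elt α β} (he : e ∈ side B Elt.b) :
    construction L p q N lA lB ／ {e} = construction (L.moveTowards p q) p q N lA lB ／ {e} := by
  have hq' := hq.mem_ground
  have hB : (construction L p q N lA lB).Indep (side B Elt.b) := by
    simpa using (construction_indep_union_side_right_iff h hp hq' hpq (empty_subset _)).2 (by simpa)
  exact contract_singleton_eq_of_indep_iff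
    (construction_ground_congr h (moveTowards_ground L hp)).symm (hB.isNonloop_of_mem he)
    fun I hI heI ↦ (construction_moveTowards_left_indep_iff h hp hq' hpq hI
      fun _ ↦ ⟨e, he, heI⟩).symm

lemma construction_moveTowards_right_contract (h : BasisPartition N A B lA lB)
    (hp : L.IsNonloop p) (hq : q ∈ L.E) (hpq : p ≠ q) {e : Elt α β} (he : e ∈ side A Elt.a) :
    construction L p q N lA lB ／ {e} = construction (L.moveTowards q p) p q N lA lB ／ {e} := by
  have hp' := hp.mem_ground
  have hA : (construction L p q N lA lB).Indep (side A Elt.a) := by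
    simpa using (construction_indep_union_side_left_iff h hp' hq hpq (empty_subset _)).2 (by simpa)
  exact contract_singleton_eq_of_indep_iff
    (construction_ground_congr h (moveTowards_ground L hq)).symm (hA.isNonloop_of_mem he)
    fun I hI heI ↦ (construction_moveTowards_right_indep_iff h hp' hq hpq hI
      fun _ ↦ ⟨e, he, heI⟩).symm

end ConstructionMinors

section Representable

variable {F : Type*} [Field F] [Infinite F] {α β : Type*}

lemma finite_placeFreely (M : Matroid α) [M.Finite] (S : Set α) (e : α) :
    (M.placeFreely S e).Finite :=
  ⟨by simpa using M.ground_finite⟩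

lemma representableOver_placeLifts {M : Matroid (Elt α β)} [hMfin : M.Finite]
    (hM : M.RepresentableOver F) (c : Elt α β) (l : List β) :
    (M.placeLifts c l).Finite ∧ (M.placeLifts c l).RepresentableOver F := by
  induction l generalizing M with
  | nil => exact ⟨hMfin, hM⟩
  | cons x _ ih =>
    have := finite_placeFreely M {Elt.ofN x, c} (Elt.lift x)
    exact ih (representableOver_placeFreely hM _ _)

lemma representableOver_construction {L : Matroid α} {N : Matroid β} [L.Finite] [N.Finite]
    (hL : L.RepresentableOver F) (hN : N.RepresentableOver F) (p q : α) (lA lB : List β) :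
    (construction L p q N lA lB).RepresentableOver F := by
  have h₀ : ((N.sum L).mapEmbedding (Elt.ofSum : β ⊕ α ↪ Elt α β)).Finite := by
    refine ⟨?_⟩
    rw [mapEmbedding_ground_eq, sum_ground]
    exact ((N.ground_finite.image _).union (L.ground_finite.image _)).image _
  have h₁ := finite_placeFreely ((N.sum L).mapEmbedding (Elt.ofSum : β ⊕ α ↪ Elt α β))
    (insert (Elt.ofL p) (Elt.ofN '' N.E)) Elt.a
  have h₂ : (placeApexes L p q N).Finite := finite_placeFreely _ _ _
  have hr : (placeApexes L p q N).RepresentableOver F :=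
    representableOver_placeFreely (representableOver_placeFreely
      (representableOver_mapEmbedding (representableOver_sum hN hL) _) _ _) _ _
  obtain ⟨h₃, hr₃⟩ := representableOver_placeLifts hr Elt.a lA
  obtain ⟨-, hr₄⟩ := representableOver_placeLifts hr₃ Elt.b lB
  exact representableOver_delete
    (representableOver_mapEmbedding (representableOver_delete hr₄ _) Elt.swapLift.toEmbedding) _

lemma representableOver_construction_delete_contract_ofL {L : Matroid α} {p q : α} {N : Matroid β}
    {A B : Set β} {lA lB : List β} (h : BasisPartition N A B lA lB) (hL : L.IsExcludedMinorFor F)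
    (hp : p ∈ L.E) (hq : q ∈ L.E) (hpq : p ≠ q) (hN : N.RepresentableOver F) {x : α}
    (hx : x ∈ L.E \ {p, q}) :
    (construction L p q N lA lB ＼ {Elt.ofL x}).RepresentableOver F ∧
      (construction L p q N lA lB ／ {Elt.ofL x}).RepresentableOver F := by
  obtain ⟨hxp, hxq⟩ : x ≠ p ∧ x ≠ q := by simpa using hx.2
  have hLfin : L.Finite := hL.1
  have hNfin : N.Finite := h.matroid_finite
  have hdelete : (construction L p q N lA lB ＼ {Elt.ofL x}).RepresentableOver F := by
    rw [construction_delete_ofL h hp hq hpq hxp hxq]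
    exact representableOver_construction
      (hL.2.2 _ (delete_singleton_isStrictMinor hx.1)) hN ..
  refine ⟨hdelete, ?_⟩
  by_cases hx_nonloop : L.IsNonloop x
  · rw [construction_contract_ofL h hp hq hpq hx_nonloop hxp hxq]
    exact representableOver_construction
      (hL.2.2 _ (contract_singleton_isStrictMinor hx.1)) hN ..
  · have hxE : Elt.ofL x ∈ (construction L p q N lA lB).E := by
      rw [construction_ground h]
      exact .inl (mem_image_of_mem _ hx)
    rw [← construction_isNonloop_ofL_iff h hp hq hpq hx, not_isNonloop_iff] at hx_nonloop
    rwa [contract_eq_delete_of_subset_loops (singleton_subset_iff.2 hx_nonloop)]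

lemma representableOver_construction_delete_contract {L : Matroid α} {p q : α} {N : Matroid β}
    {A B : Set β} {lA lB : List β} (h : BasisPartition N A B lA lB) (hL : L.IsExcludedMinorFor F)
    (hLi : L.Indep {p, q}) (hpq : p ≠ q) (hLpq : (L.moveTowards p q).RepresentableOver F)
    (hLqp : (L.moveTowards q p).RepresentableOver F) (hN : N.RepresentableOver F) {e : Elt α β}
    (he : e ∈ (construction L p q N lA lB).E) :
    (construction L p q N lA lB ＼ {e}).RepresentableOver F ∧
      (construction L p q N lA lB ／ {e}).RepresentableOver F := by
  have hp : L.IsNonloop p := hLi.isNonloop_of_mem (by simp)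
  have hq : L.IsNonloop q := hLi.isNonloop_of_mem (by simp)
  obtain ⟨hp', hq'⟩ := And.intro hp.mem_ground hq.mem_ground
  have hLfin : L.Finite := hL.1
  have hNfin : N.Finite := h.matroid_finite
  have hLpq_fin : (L.moveTowards p q).Finite := ⟨by simpa [hp'] using L.ground_finite⟩
  have hLqp_fin : (L.moveTowards q p).Finite := ⟨by simpa [hq'] using L.ground_finite⟩
  have hMpq := representableOver_construction hLpq hN p q lA lB
  have hMqp := representableOver_construction hLqp hN p q lA lB
  rw [construction_ground h] at he
  obtain ⟨x, hx, rfl⟩ | he | he := he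
  · exact representableOver_construction_delete_contract_ofL h hL hp' hq' hpq hN hx
  · rw [← construction_moveTowards_left_delete h hp' hq' hpq he,
      construction_moveTowards_right_contract h hp hq' hpq he]
    exact ⟨representableOver_delete hMpq _, representableOver_contract hMqp _⟩
  · rw [← construction_moveTowards_right_delete h hp' hq' hpq he,
      construction_moveTowards_left_contract h hp' hq hpq he]
    exact ⟨representableOver_delete hMqp _, representableOver_contract hMpq _⟩

end Representable

/-! ### Recovering a representation of `L` -/

section LinearAlgebra

variable {F : Type*} [Field F] {V V' : Type*} [AddCommGroup V] [Module F V] [AddCommGroup V']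
  [Module F V'] {α : Type*} {w : α → V} {X T : Set α}

lemma linearIndepOn_comp_iff (f : V →ₗ[F] V') :
    LinearIndepOn F (f ∘ w) X ↔
      LinearIndepOn F w X ∧ Disjoint (span F (w '' X)) (LinearMap.ker f) := by
  rw [image_eq_range]
  exact ⟨fun h ↦ ⟨h.of_comp f, Submodule.range_ker_disjoint h⟩, fun h ↦ h.1.map h.2⟩

lemma linearIndepOn_mkQ_union_iff {W : Submodule F V} (hT : LinearIndepOn F (W.mkQ ∘ w) T)
    (hXT : Disjoint X T) :
    LinearIndepOn F (W.mkQ ∘ w) (X ∪ T) ↔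
      LinearIndepOn F w X ∧ Disjoint (span F (w '' X)) (W ⊔ span F (w '' T)) := by
  rw [union_comm, ← hT.quotient_iff_union hXT.symm, ← Function.comp_assoc, ← LinearMap.coe_comp,
    linearIndepOn_comp_iff, LinearMap.ker_comp, ker_mkQ, image_comp, span_image, comap_map_mkQ]

lemma linearIndepOn_mkQ_pair {U₁ U₂ : Submodule F V} {i j : α} (hij : i ≠ j) (hi₁ : w i ∈ U₁)
    (hi₂ : w i ∉ U₂) (hj₁ : w j ∉ U₁) (hj₂ : w j ∈ U₂) :
    LinearIndepOn F ((U₁ ⊓ U₂).mkQ ∘ w) {i, j} := by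
  refine (LinearIndepOn.pair_iff _ hij).2 fun c d hcd ↦ ?_
  have hcd_mem : c • w i + d • w j ∈ U₁ ⊓ U₂ := by
    rw [← (U₁ ⊓ U₂).ker_mkQ, LinearMap.mem_ker, map_add, map_smul, map_smul]
    exact hcd
  obtain ⟨h₁, h₂⟩ := mem_inf.1 hcd_mem
  rw [U₁.add_mem_iff_right (U₁.smul_mem c hi₁)] at h₁
  rw [U₂.add_mem_iff_left (U₂.smul_mem d hj₂)] at h₂
  exact ⟨by_contra fun hc ↦ hi₂ ((U₂.smul_mem_iff hc).1 h₂),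
    by_contra fun hd ↦ hj₁ ((U₁.smul_mem_iff hd).1 h₁)⟩

lemma inf_sup_eq_left_of_le {ι : Type*} [Lattice ι] [IsModularLattice ι] {x y z : ι} (hzx : z ≤ x)
    (hx : x ≤ y ⊔ z) : x ⊓ y ⊔ z = x := by
  rw [inf_sup_assoc_of_le y hzx, inf_eq_left.2 hx]

/-- `S ⊓ U₁` is at most a line, and it is spanned by `z`. -/
lemma disjoint_inf_of_le_sup_span {S U₀ U₁ U₂ : Submodule F V} {u z : V} (hS : Disjoint S U₀)
    (hU : U₁ ≤ U₀ ⊔ span F {u}) (hzS : z ∈ S) (hz₁ : z ∈ U₁) (hz₂ : z ∉ U₂) :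
    Disjoint S (U₁ ⊓ U₂) := by
  rw [disjoint_def]
  rintro s hsS ⟨hs₁, hs₂⟩
  obtain ⟨y, hy, _, hcu, hz⟩ := mem_sup.1 (hU hz₁)
  obtain ⟨c, rfl⟩ := mem_span_singleton.1 hcu
  obtain ⟨y', hy', _, hdu, hs⟩ := mem_sup.1 (hU hs₁)
  obtain ⟨d, rfl⟩ := mem_span_singleton.1 hdu
  have hc : c ≠ 0 := by
    rintro rfl
    obtain rfl : y = z := by simpa using hz
    exact hz₂ (disjoint_def.1 hS y hzS hy ▸ U₂.zero_mem)
  have hsz : s = (d / c) • z := by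
    have h_eq : s - (d / c) • z = y' - (d / c) • y := by
      rw [← hz, ← hs, smul_add, smul_smul, div_mul_cancel₀ d hc]
      abel
    refine sub_eq_zero.1 (disjoint_def.1 hS _ (S.sub_mem hsS (S.smul_mem _ hzS)) ?_)
    exact h_eq ▸ U₀.sub_mem hy' (U₀.smul_mem _ hy)
  have hdc : d / c = 0 := by
    by_contra hdc
    exact hz₂ ((U₂.smul_mem_iff hdc).1 (hsz ▸ hs₂))
  rw [hsz, hdc, zero_smul]

end LinearAlgebra

section Configuration

variable {F : Type*} [Field F] {V : Type*} [AddCommGroup V] [Module F V] {α β : Type*}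
  {L : Matroid α} {p q : α} {w : α → V} {U₀ U₁ U₂ : Submodule F V}

/-- The position, relative to the flats `U₁` of `A ∪ {a}` and `U₂` of `B ∪ {b}` and to the flat `U₀`
of `A`, of the vectors `w` read off a representation of `M(L, p, q; N, A, B)`, where `w p` and `w q`
are the vectors of `a` and `b`. -/
structure ApexConfiguration (L : Matroid α) (p q : α) (w : α → V) (U₀ U₁ U₂ : Submodule F V) :
    Prop where
  mem_left : w p ∈ U₁
  mem_right : w q ∈ U₂
  notMem_left : w q ∉ U₁
  notMem_right : w p ∉ U₂
  left_le : U₁ ≤ U₀ ⊔ span F {w p}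
  left_le_sup : U₁ ≤ U₂ ⊔ span F {w p}
  right_le_sup : U₂ ≤ U₁ ⊔ span F {w q}
  indep_iff : ∀ X ⊆ L.E \ {p, q}, L.Indep X ↔ LinearIndepOn F w X
  disjoint_of_indep : ∀ X ⊆ L.E \ {p, q}, L.Indep X → Disjoint (span F (w '' X)) U₀
  indep_insert_left_iff : ∀ X ⊆ L.E \ {p, q},
    L.Indep (insert p X) ↔ LinearIndepOn F w X ∧ Disjoint (span F (w '' X)) U₁
  indep_insert_right_iff : ∀ X ⊆ L.E \ {p, q},
    L.Indep (insert q X) ↔ LinearIndepOn F w X ∧ Disjoint (span F (w '' X)) U₂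
  indep_insert_insert_iff : ∀ X ⊆ L.E \ {p, q},
    L.Indep (insert p (insert q X)) ↔
      LinearIndepOn F w X ∧ Disjoint (span F (w '' X)) (U₁ ⊔ span F {w q})

namespace ApexConfiguration

variable (h : ApexConfiguration L p q w U₀ U₁ U₂)
include h

lemma exists_mem_span_mem_left_notMem_right (hpq : L.IncomparablePair p q) :
    ∃ z ∈ span F (w '' (L.E \ {p, q})), z ∈ U₁ ∧ z ∉ U₂ := by
  obtain ⟨-, hq, ⟨Y, hY, hpY, hqY⟩, -⟩ := hpq
  obtain ⟨I, hI⟩ := L.exists_isBasis Y (hY.trans sdiff_subset)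
  have hIY := hI.subset.trans hY
  rw [← hI.closure_eq_closure] at hpY hqY
  have hpI : p ∉ I := fun hpI ↦ (hIY hpI).2 (.inl rfl)
  have hpI_dep : ¬ L.Indep (insert p I) :=
    ((hI.indep.mem_closure_iff_of_notMem hpI).1 hpY).not_indep
  have hqI_indep : L.Indep (insert q I) := hI.indep.insert_indep_iff.2 (.inl ⟨hq, hqY⟩)
  rw [h.indep_insert_left_iff I hIY, ← h.indep_iff I hIY, and_iff_right hI.indep,
    disjoint_def] at hpI_dep
  push Not at hpI_dep
  obtain ⟨z, hzI, hz₁, hz_ne⟩ := hpI_dep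
  exact ⟨z, span_mono (image_mono hIY) hzI, hz₁, fun hz₂ ↦
    hz_ne (disjoint_def.1 ((h.indep_insert_right_iff I hIY).1 hqI_indep).2 z hzI hz₂)⟩

lemma disjoint_span_inf (hpq : L.IncomparablePair p q) :
    Disjoint (span F (w '' (L.E \ {p, q}))) (U₁ ⊓ U₂) := by
  obtain ⟨z, hzS, hz₁, hz₂⟩ := h.exists_mem_span_mem_left_notMem_right hpq
  refine disjoint_inf_of_le_sup_span ?_ h.left_le hzS hz₁ hz₂
  have h_rep : Represents F (L ＼ {p, q}) w := fun X hX ↦ by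
    rw [delete_indep_iff, and_iff_left (subset_sdiff.1 hX).2, h.indep_iff X hX]
  obtain ⟨I, hI⟩ := (L ＼ {p, q}).exists_isBasis (L ＼ {p, q}).E
  rw [← delete_ground, ← h_rep.span_image_eq_of_isBasis hI]
  exact h.disjoint_of_indep I hI.subset hI.indep.of_delete

lemma represents_mkQ (hpq : L.IncomparablePair p q) : Represents F L ((U₁ ⊓ U₂).mkQ ∘ w) := by
  have hne : p ≠ q := by
    rintro rfl
    exact h.notMem_left h.mem_left
  have hli := linearIndepOn_mkQ_pair (F := F) hne h.mem_left h.notMem_right h.notMem_left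
    h.mem_right
  have h₁ : U₁ ⊓ U₂ ⊔ span F {w p} = U₁ :=
    inf_sup_eq_left_of_le ((span_singleton_le_iff_mem _ _).2 h.mem_left) h.left_le_sup
  have h₂ : U₁ ⊓ U₂ ⊔ span F {w q} = U₂ := by
    rw [inf_comm]
    exact inf_sup_eq_left_of_le ((span_singleton_le_iff_mem _ _).2 h.mem_right) h.right_le_sup
  intro I hI
  have hX : I \ {p, q} ⊆ L.E \ {p, q} := sdiff_subset_sdiff_left hI
  have hP : I ∩ {p, q} ⊆ {p, q} := inter_subset_right
  rw [← sdiff_union_inter I {p, q}, linearIndepOn_mkQ_union_iff (hli.mono hP)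
    (disjoint_sdiff_left.mono_right hP)]
  obtain hP | hP | hP | hP := subset_pair_iff_eq.1 hP <;> rw [hP]
  · have hdisj : Disjoint (span F (w '' (I \ {p, q}))) (U₁ ⊓ U₂) :=
      (h.disjoint_span_inf hpq).mono_left (span_mono (image_mono hX))
    simp only [union_empty, image_empty, span_empty, sup_bot_eq, hdisj, and_true, h.indep_iff _ hX]
  · rw [union_singleton, image_singleton, h₁, h.indep_insert_left_iff _ hX]
  · rw [union_singleton, image_singleton, h₂, h.indep_insert_right_iff _ hX]
  · rw [union_insert, union_singleton, image_pair, span_insert, ← sup_assoc, h₁,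
      h.indep_insert_insert_iff _ hX]

end ApexConfiguration

end Configuration

section Recovery

variable {F : Type*} [Field F] {V : Type*} [AddCommGroup V] [Module F V] {α β γ : Type*}

lemma Represents.indep_image_union_iff {M : Matroid γ} {v : γ → V} (hv : Represents F M v)
    {f : α → γ} {X : Set α} (hf : InjOn f X) (hX : f '' X ⊆ M.E) {T : Set γ} (hT : M.Indep T)
    (hXT : Disjoint (f '' X) T) :
    M.Indep (f '' X ∪ T) ↔
      LinearIndepOn F (v ∘ f) X ∧ Disjoint (span F ((v ∘ f) '' X)) (span F (v '' T)) := by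
  rw [hv _ (union_subset hX hT.subset_ground), linearIndepOn_union_iff hXT,
    linearIndepOn_image_iff hf, and_iff_right ((hv T hT.subset_ground).1 hT), image_comp]

lemma indep_pair_of_incomparablePair {L : Matroid α} {p q : α} (hpq : L.IncomparablePair p q) :
    L.Indep {p, q} := by
  obtain ⟨-, hq, ⟨Y, -, hpY, hqY⟩, ⟨Y', -, -, hpY'⟩⟩ := hpq
  have hpi : L.Indep {p} := by
    rw [indep_singleton, ← not_isLoop_iff]
    exact fun hp_loop ↦ hpY' (hp_loop.mem_closure Y')
  rw [pair_comm, hpi.insert_indep_iff]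
  refine .inl ⟨hq, fun hqp ↦ hqY ?_⟩
  exact L.closure_subset_closure_of_subset_closure (singleton_subset_iff.2 hpY) hqp

lemma ne_of_incomparablePair {L : Matroid α} {p q : α} (hpq : L.IncomparablePair p q) : p ≠ q := by
  obtain ⟨-, -, ⟨Y, -, hpY, hqY⟩, -⟩ := hpq
  rintro rfl
  exact hqY hpY

open Classical in
/-- The element of `M(L, p, q; N, A, B)` that plays the role of a given element of `L`: the apexes
`a` and `b` stand for the deleted elements `p` and `q`. -/
noncomputable def standIn (p q x : α) : Elt α β :=
  if x = p then Elt.a else if x = q then Elt.b else Elt.ofL x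

lemma standIn_left (p q : α) : (standIn p q p : Elt α β) = Elt.a :=
  if_pos rfl

lemma standIn_right {p q : α} (hpq : p ≠ q) : (standIn p q q : Elt α β) = Elt.b := by
  rw [standIn, if_neg hpq.symm, if_pos rfl]

lemma eqOn_standIn (p q : α) : EqOn (standIn p q) (Elt.ofL : α → Elt α β) {p, q}ᶜ := by
  intro x hx
  rw [mem_compl_iff, mem_insert_iff, mem_singleton_iff, not_or] at hx
  rw [standIn, if_neg hx.1, if_neg hx.2]

variable {L : Matroid α} {p q : α} {N : Matroid β} {A B : Set β} {lA lB : List β}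
  {v : Elt α β → V}

lemma construction_indep_union_iff_linearIndepOn (h : BasisPartition N A B lA lB)
    (hv : Represents F (construction L p q N lA lB) v) {X : Set α} (hX : X ⊆ L.E \ {p, q})
    {T : Set (Elt α β)} (hT : T ⊆ side A Elt.a ∪ side B Elt.b)
    (hTi : (construction L p q N lA lB).Indep T) :
    (construction L p q N lA lB).Indep (Elt.ofL '' X ∪ T) ↔
      LinearIndepOn F (v ∘ standIn p q) X ∧
        Disjoint (span F ((v ∘ standIn p q) '' X)) (span F (v '' T)) := by
  have h_eqOn : EqOn (standIn p q) (Elt.ofL : α → Elt α β) X :=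
    (eqOn_standIn p q).mono fun x hx ↦ (hX hx).2
  rw [← h_eqOn.image_eq]
  refine hv.indep_image_union_iff ?_ ?_ hTi ?_
  · exact (injOn_of_injective fun _ _ ↦ Elt.ofL.inj).congr h_eqOn.symm
  · rw [h_eqOn.image_eq, construction_ground h]
    exact (image_mono hX).trans subset_union_left
  · rw [h_eqOn.image_eq, disjoint_left]
    rintro _ ⟨x, -, rfl⟩ hxT
    simpa [side] using hT hxT

lemma Represents.notMem_span_of_indep_insert {M : Matroid γ} {v : γ → V} (hv : Represents F M v)
    {T : Set γ} {e : γ} (he : e ∉ T) (hT : M.Indep (insert e T)) : v e ∉ span F (v '' T) :=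
  ((linearIndepOn_insert he).1 ((hv _ hT.subset_ground).1 hT)).2

lemma span_union_side_le (h : BasisPartition N A B lA lB) (hp : p ∈ L.E) (hq : q ∈ L.E)
    (hpq : p ≠ q) (hv : Represents F (construction L p q N lA lB) v) {T : Set (Elt α β)}
    (hT : T ⊆ side A Elt.a ∪ side B Elt.b) (hTi : (construction L p q N lA lB).Indep T)
    (hT_card : A.ncard + 2 ≤ T.ncard) :
    span F (v '' (side A Elt.a ∪ side B Elt.b)) ≤ span F (v '' T) := by
  refine span_le.2 ?_
  rintro _ ⟨e, he, rfl⟩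
  have he_cl := union_side_subset_closure h hp hq hpq hT hTi hT_card he
  exact (hv.mem_closure_iff hTi.subset_ground (mem_ground_of_mem_closure he_cl)).1 he_cl

section Sides

variable (h : BasisPartition N A B lA lB) (hp : p ∈ L.E) (hq : q ∈ L.E) (hpq : p ≠ q)
  (hLi : L.Indep {p, q})
include h hp hq hpq hLi

lemma construction_indep_insert_side_left :
    (construction L p q N lA lB).Indep (insert Elt.b (side A Elt.a)) := by
  have := construction_indep_union_insert_side_left_iff h hp hq hpq (empty_subset _)
  rw [image_empty, empty_union, insert_empty_eq] at this
  exact this.2 hLi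

lemma construction_indep_insert_side_right :
    (construction L p q N lA lB).Indep (insert Elt.a (side B Elt.b)) := by
  have := construction_indep_union_insert_side_right_iff h hp hq hpq (empty_subset _)
  rw [image_empty, empty_union, insert_empty_eq, pair_comm] at this
  exact this.2 hLi

variable (hv : Represents F (construction L p q N lA lB) v)
include hv

lemma span_side_right_le :
    span F (v '' side B Elt.b) ≤ span F (v '' side A Elt.a) ⊔ span F {v Elt.b} := by
  rw [sup_comm, ← span_insert, ← image_insert_eq]
  refine (span_mono (image_mono subset_union_right)).trans (span_union_side_le h hp hq hpq hv
    (insert_subset (.inr (.inl rfl)) subset_union_left)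
    (construction_indep_insert_side_left h hp hq hpq hLi) ?_)
  rw [ncard_insert_of_notMem (by simp [side]) (finite_side h.finite_left _),
    ncard_side h.finite_left (by simp)]

lemma span_side_left_le :
    span F (v '' side A Elt.a) ≤ span F (v '' side B Elt.b) ⊔ span F {v Elt.a} := by
  rw [sup_comm, ← span_insert, ← image_insert_eq]
  refine (span_mono (image_mono subset_union_left)).trans (span_union_side_le h hp hq hpq hv
    (insert_subset (.inl (.inl rfl)) subset_union_right)
    (construction_indep_insert_side_right h hp hq hpq hLi) ?_)
  rw [ncard_insert_of_notMem (by simp [side]) (finite_side h.finite_right _),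
    ncard_side h.finite_right (by simp), h.ncard_eq]

lemma apexConfiguration_of_represents :
    ApexConfiguration L p q (v ∘ standIn p q) (span F (v '' (Elt.ofN '' A)))
      (span F (v '' side A Elt.a)) (span F (v '' side B Elt.b)) := by
  have hleft := construction_indep_insert_side_left h hp hq hpq hLi
  have hright := construction_indep_insert_side_right h hp hq hpq hLi
  have h_iff : ∀ X ⊆ L.E \ {p, q}, ∀ T ⊆ side A Elt.a ∪ side B Elt.b, _ := fun X hX T hT ↦
    construction_indep_union_iff_linearIndepOn h hv hX hT
  have hw_left : (v ∘ standIn p q) p = v Elt.a := congrArg v (standIn_left p q)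
  have hw_right : (v ∘ standIn p q) q = v Elt.b := congrArg v (standIn_right hpq)
  constructor
  case mem_left => exact hw_left ▸ subset_span (mem_image_of_mem v (.inl rfl))
  case mem_right => exact hw_right ▸ subset_span (mem_image_of_mem v (.inl rfl))
  case notMem_left => exact hw_right ▸ hv.notMem_span_of_indep_insert (by simp [side]) hleft
  case notMem_right => exact hw_left ▸ hv.notMem_span_of_indep_insert (by simp [side]) hright
  case left_le => rw [hw_left, side, image_insert_eq, span_insert, sup_comm]
  case left_le_sup => exact hw_left ▸ span_side_left_le h hp hq hpq hLi hv
  case right_le_sup => exact hw_right ▸ span_side_right_le h hp hq hpq hLi hv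
  case indep_iff =>
    intro X hX
    rw [← construction_indep_ofL_image_iff h hp hq hpq hX]
    simpa using h_iff X hX ∅ (empty_subset _) (empty_indep _)
  case disjoint_of_indep =>
    intro X hX hXi
    have hi := construction_indep_union_ofN_image h hp hq hpq hX hXi
    exact ((h_iff X hX _ ((subset_insert _ _).trans subset_union_left)
      (hi.subset subset_union_right)).1 hi).2
  case indep_insert_left_iff =>
    intro X hX
    rw [← construction_indep_union_side_left_iff h hp hq hpq hX,
      h_iff X hX _ subset_union_left (hleft.subset (subset_insert _ _))]
  case indep_insert_right_iff =>
    intro X hX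
    rw [← construction_indep_union_side_right_iff h hp hq hpq hX,
      h_iff X hX _ subset_union_right (hright.subset (subset_insert _ _))]
  case indep_insert_insert_iff =>
    intro X hX
    rw [← construction_indep_union_insert_side_left_iff h hp hq hpq hX,
      h_iff X hX _ (insert_subset (.inr (.inl rfl)) subset_union_left) hleft, image_insert_eq,
      span_insert, sup_comm, hw_right]

end Sides

lemma not_representableOver_construction (h : BasisPartition N A B lA lB)
    (hL : ¬ L.RepresentableOver F) (hpq : L.IncomparablePair p q) :
    ¬ (construction L p q N lA lB).RepresentableOver F := by
  intro hM
  obtain ⟨n, v, hv⟩ := exists_represents hM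
  have h_config := apexConfiguration_of_represents h hpq.1 hpq.2.1 (ne_of_incomparablePair hpq)
    (indep_pair_of_incomparablePair hpq) hv
  exact hL (h_config.represents_mkQ hpq).representableOver

end Recovery

end MatroidConstruction

theorem theorem4p1 {F : Type*} [Field F] [Infinite F] {α β : Type*}
    (L : Matroid α) (hL : L.IsExcludedMinorFor F)
    (p q : α) (hpq : L.IncomparablePair p q)
    (hLpq : (L.moveTowards p q).RepresentableOver F)
    (hLqp : (L.moveTowards q p).RepresentableOver F)
    (N : Matroid β) (hN : N.RepresentableOver F)
    (A B : Set β) (hA : N.IsBase A) (hB : N.IsBase B)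
    (hdisj : Disjoint A B) (hunion : A ∪ B = N.E)
    (lA lB : List β) (hlA : lA.Nodup) (hlA_mem : ∀ x, x ∈ lA ↔ x ∈ A)
    (hlB : lB.Nodup) (hlB_mem : ∀ x, x ∈ lB ↔ x ∈ B) :
    (Matroid.construction L p q N lA lB).IsExcludedMinorFor F := by
  have h : MatroidConstruction.BasisPartition N A B lA lB :=
    ⟨hA, hB, hdisj, hunion, hlA, hlB, hlA_mem, hlB_mem⟩
  refine ⟨MatroidConstruction.construction_finite hL.1 h,
    MatroidConstruction.not_representableOver_construction h hL.2.1 hpq, fun M' hM' ↦ ?_⟩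
  obtain ⟨e, he, hM'_le⟩ := MatroidConstruction.exists_isMinor_delete_or_contract_singleton hM'
  obtain ⟨h_delete, h_contract⟩ :=
    MatroidConstruction.representableOver_construction_delete_contract h hL
      (MatroidConstruction.indep_pair_of_incomparablePair hpq)
      (MatroidConstruction.ne_of_incomparablePair hpq) hLpq hLqp hN he
  exact hM'_le.elim (MatroidConstruction.representableOver_of_isMinor h_delete)
    (MatroidConstruction.representableOver_of_isMinor h_contract)
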